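/- Let $n\in\mathbb N$, $r>0$, $p\in(1,\infty)$, and let $f:C^0([-r,0];\mathbb R^n)\to\mathbb R^n$ satisfy $f(0)=0$ and be Lipschitz on bounded sets: there is a non-decreasing $L:[0,\infty)\to[0,\infty)$ with $|f(x)-f(y)|\le L(R)\|x-y\|_\infty$ whenever $\|x\|_\infty\le R$ and $\|y\|_\infty\le R$. Consider the delay system $\dot x(t)=f(x_t)$, where $x_t(s)=x(t+s)$ for $s\in[-r,0]$, and write $\phi(t,x_0)=x_t$ for its solution with initial condition $x_0$. Let $X=W^{1,p}([-r,0])$ be the space of absolutely continuous functions $x:[-r,0]\to\mathbb R^n$ with $\dot x\in L^p((-r,0);\mathbb R^n)$, with norm $\|x\|_X=\|x\|_\infty+\|\dot x\|_p$. Assume that for every initial condition $x_0$ in the Hölder space $C^{0,1-1/p}([-r,0])$ the solution exists for all $t\ge 0$. Write $K$ for the strictly increasing continuous functions $\rho:[0,\infty)\to[0,\infty)$ with $\rho(0)=0$, $K_\infty$ for the unbounded functions in $K$, and $KL$ for the functions $\sigma:[0,\infty)^2\to[0,\infty)$ such that $\sigma(\cdot,t)\in K$ for every $t\ge 0$ and,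 for every $s\ge 0$, $\sigma(s,\cdot)$ is non-increasing with $\lim_{t\to\infty}\sigma(s,t)=0$. A functional $V:X\to[0,\infty)$ is called Lipschitz on bounded sets of $X$ if there is a non-decreasing $L:[0,\infty)\to[0,\infty)$ with $|V(x)-V(y)|\le L(R)\|x-y\|_X$ whenever $\|x\|_X\le R$ and $\|y\|_X\le R$. Then the following four statements are equivalent. (i) (GAS-X) For every $\varepsilon>0$ there is $\delta>0$ such that $\|\phi(t,x_0)\|_X\le\varepsilon$ for all $t\ge0$ and all $x_0\in X$ with $\|x_0\|_X\le\delta$; and $\lim_{t\to\infty}\|\phi(t,x_0)\|_X=0$ for every $x_0\in X$. (ii) (UGAS-X) There is $\sigma\in KL$ such that $\|\phi(t,x_0)\|_X\le\sigma(\|x_0\|_X,t)$ for all $t\ge 0$ and all $x_0\in X$. (iii) There are a functional $V:X\to[0,\infty)$ that is Lipschitz on bounded sets of $X$ and functions $a_1,a_2\in K_\infty$ such that, for all $x\in X$, $a_1(\|x\|_X)\le V(x)\le a_2(\|x\|_X)$ and $$\limsup_{t\to0^+}t^{-1}\bigl(V(\phi(t,x))-V(x)\bigr)\le -V(x).$$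 (iv) There are a functional $V:X\to[0,\infty)$ that is Lipschitz on bounded sets of $X$, a continuous positive definite function $Q:\mathbb R^n\to[0,\infty)$ (that is, $Q(v)=0$ if and only if $v=0$), and functions $a_1,a_2\in K_\infty$ such that, for all $x\in X$, $a_1(|x(0)|)\le V(x)\le a_2(\|x\|_X)$ and $$\limsup_{t\to0^+}t^{-1}\bigl(V(\phi(t,x))-V(x)\bigr)\le -Q(x(0)).$$ -/

import Mathlib

open Set Filter Topology MeasureTheory
open scoped NNReal ENNReal

noncomputable section

namespace DelaySystem

/-! ### Comparison functions -/

/-- Class `K`: (strictly) increasing continuous functions on `[0, ∞)` vanishing at `0`. -/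
structure ClassK (ρ : ℝ≥0 → ℝ≥0) : Prop where
  continuous : Continuous ρ
  strictMono : StrictMono ρ
  map_zero : ρ 0 = 0

/-- Class `K_∞`: unbounded functions of class `K`. -/
structure ClassKInf (ρ : ℝ≥0 → ℝ≥0) : Prop extends ClassK ρ where
  tendsto_atTop : Tendsto ρ atTop atTop

/-- Class `KL`: `σ s t` is of class `K` in `s`, and non-increasing with limit `0` in `t`. -/
structure ClassKL (σ : ℝ≥0 → ℝ≥0 → ℝ≥0) : Prop where
  classK : ∀ t, ClassK fun s => σ s t
  antitone : ∀ s, Antitone (σ s)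
  tendsto_zero : ∀ s, Tendsto (σ s) atTop (𝓝 0)

/-! ### Spaces of initial data -/

/-- `ℝⁿ` with the Euclidean norm. -/
abbrev Vec (n : ℕ) : Type := EuclideanSpace ℝ (Fin n)

/-- `C⁰([-r, 0]; ℝⁿ)` with the sup norm. -/
abbrev History (n : ℕ) (r : ℝ) : Type := C(Icc (-r) (0 : ℝ), Vec n)

/-- A function on `[-r, 0]` regarded as a function on `ℝ` (by the irrelevant value `0` outside
`[-r, 0]`), so that absolute continuity on `[-r, 0]` and the derivative on `(-r, 0)` can be
expressed. -/
def extendZero {n : ℕ} {r : ℝ} (x : History n r) : ℝ → Vec n :=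
  Function.extend Subtype.val x 0

/-- The Sobolev space `W^{1,p}([-r, 0])`: absolutely continuous functions `[-r, 0] → ℝⁿ` whose
(almost everywhere defined) derivative is in `L^p((-r, 0); ℝⁿ)`. -/
def sobolevSet (n : ℕ) (r : ℝ) (p : ℝ≥0) : Set (History n r) :=
  {x | AbsolutelyContinuousOnInterval (extendZero x) (-r) 0 ∧
    MemLp (deriv (extendZero x)) p (volume.restrict (Ioo (-r) 0))}

/-- `W^{1,p}([-r, 0])` as a type. -/
abbrev Sobolev (n : ℕ) (r : ℝ) (p : ℝ≥0) : Type := sobolevSet n r p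

/-- The Sobolev norm `‖x‖_∞ + ‖ẋ‖_p`, for `x` in `W^{1,p}([-r, 0])`. -/
def sobolevNorm {n : ℕ} {r : ℝ} (p : ℝ≥0) (x : History n r) : ℝ≥0 :=
  ‖x‖₊ + (eLpNorm (deriv (extendZero x)) p (volume.restrict (Ioo (-r) 0))).toNNReal

/-- The Hölder space `C^{0,a}([-r, 0])`. -/
def holderSet (n : ℕ) (r : ℝ) (a : ℝ≥0) : Set (History n r) :=
  {x | MemHolder a x}

/-! ### The delay system `x'(t) = f(x_t)` -/

/-- `f` is Lipschitz on bounded sets of `C⁰([-r, 0]; ℝⁿ)`. -/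
def RhsLipschitzOnBounded {n : ℕ} {r : ℝ} (f : History n r → Vec n) : Prop :=
  ∃ L : ℝ≥0 → ℝ≥0, Monotone L ∧ ∀ (R : ℝ≥0) (x y : History n r),
    ‖x‖ ≤ R → ‖y‖ ≤ R → ‖f x - f y‖ ≤ L R * ‖x - y‖

/-- The history segment `x_t`, given by `x_t(s) = x(t + s)` for `s ∈ [-r, 0]`. -/
def histSegment {n : ℕ} (r : ℝ) (x : C(ℝ, Vec n)) (t : ℝ) : History n r :=
  ⟨fun s => x (t + s), by fun_prop⟩

/-- `x` is a solution, existing for all `t ≥ 0`, of `x'(t) = f(x_t)` with initial condition `x₀`: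
it is continuous, equals `x₀` on `[-r, 0]`, and satisfies the equation for all `t ≥ 0` (with the
one-sided derivative at `t = 0`). Only the values of `x` on `[-r, ∞)` matter. -/
structure IsSolution {n : ℕ} {r : ℝ} (f : History n r → Vec n) (x₀ : History n r)
    (x : C(ℝ, Vec n)) : Prop where
  initial : histSegment r x 0 = x₀
  hasDeriv : ∀ t : ℝ, 0 ≤ t → HasDerivWithinAt x (f (histSegment r x t)) (Ici 0) t

/-- Forward completeness for initial data in a set `S`: for every `x₀ ∈ S` the solution exists for
all `t ≥ 0`. -/
def ForwardCompleteOn {n : ℕ} {r : ℝ} (f : History n r → Vec n) (S : Set (History n r)) : Prop :=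
  ∀ x₀ ∈ S, ∃ x : C(ℝ, Vec n), IsSolution f x₀ x

/-- `φ` is the map `t ↦ φ(t, x₀) = x_t`, `t ≥ 0`, with values in `W^{1,p}([-r, 0])`, where `x` is
the solution with initial condition `x₀`. For `f` Lipschitz on bounded sets there is at most one
such `φ`. -/
def IsTrajectory {n : ℕ} {r : ℝ} {p : ℝ≥0} (f : History n r → Vec n) (x₀ : Sobolev n r p)
    (φ : ℝ≥0 → Sobolev n r p) : Prop :=
  ∃ x : C(ℝ, Vec n), IsSolution f x₀ x ∧ ∀ t : ℝ≥0, (φ t : History n r) = histSegment r x t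

/-! ### Stability in the state space `X = W^{1,p}([-r, 0])`

Each property includes the existence of the solutions that it speaks about. -/

/-- Lyapunov stability in `X`. -/
def LyapunovStable {n : ℕ} {r : ℝ} (p : ℝ≥0) (f : History n r → Vec n) : Prop :=
  ∀ ε : ℝ≥0, 0 < ε → ∃ δ : ℝ≥0, 0 < δ ∧ ∀ x₀ : Sobolev n r p, sobolevNorm p x₀.1 ≤ δ →
    ∃ φ : ℝ≥0 → Sobolev n r p, IsTrajectory f x₀ φ ∧ ∀ t, sobolevNorm p (φ t).1 ≤ ε

/-- Global attractivity in `X`. -/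
def GloballyAttractive {n : ℕ} {r : ℝ} (p : ℝ≥0) (f : History n r → Vec n) : Prop :=
  ∀ x₀ : Sobolev n r p, ∃ φ : ℝ≥0 → Sobolev n r p, IsTrajectory f x₀ φ ∧
    Tendsto (fun t => sobolevNorm p (φ t).1) atTop (𝓝 0)

/-- Global asymptotic stability in `X`. -/
def GAS {n : ℕ} {r : ℝ} (p : ℝ≥0) (f : History n r → Vec n) : Prop :=
  LyapunovStable p f ∧ GloballyAttractive p f

/-- Uniform global asymptotic stability in `X`. -/
def UGAS {n : ℕ} {r : ℝ} (p : ℝ≥0) (f : History n r → Vec n) : Prop :=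
  ∃ σ : ℝ≥0 → ℝ≥0 → ℝ≥0, ClassKL σ ∧ ∀ x₀ : Sobolev n r p,
    ∃ φ : ℝ≥0 → Sobolev n r p, IsTrajectory f x₀ φ ∧
      ∀ t, sobolevNorm p (φ t).1 ≤ σ (sobolevNorm p x₀.1) t

/-! ### Lyapunov-Krasovskii functionals on `X` -/

/-- `V : X → ℝ₊` is Lipschitz on bounded sets of `X`. -/
def FunctionalLipschitzOnBounded {n : ℕ} {r : ℝ} {p : ℝ≥0} (V : Sobolev n r p → ℝ≥0) : Prop :=
  ∃ L : ℝ≥0 → ℝ≥0, Monotone L ∧ ∀ (R : ℝ≥0) (x y : Sobolev n r p),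
    sobolevNorm p x.1 ≤ R → sobolevNorm p y.1 ≤ R →
      |(V x : ℝ) - V y| ≤ L R * sobolevNorm p (x.1 - y.1)

/-- The inequality `limsup_{t → 0⁺} t⁻¹ (V(φ(t, x₀)) - V(x₀)) ≤ c`, the limit superior being taken
in `[-∞, ∞]`. -/
def DiniAlongLE {n : ℕ} {r : ℝ} {p : ℝ≥0} (f : History n r → Vec n) (V : Sobolev n r p → ℝ≥0)
    (x₀ : Sobolev n r p) (c : ℝ) : Prop :=
  ∃ φ : ℝ≥0 → Sobolev n r p, IsTrajectory f x₀ φ ∧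
    limsup (fun t : ℝ≥0 => (((t : ℝ)⁻¹ * ((V (φ t) : ℝ) - V x₀) : ℝ) : EReal)) (𝓝[>] 0)
      ≤ (c : EReal)

/-- Evaluation `x(0)` of a function on `[-r, 0]`. -/
def evalZero {n : ℕ} {r : ℝ} (hr : 0 < r) (x : History n r) : Vec n :=
  x ⟨0, by constructor <;> linarith⟩

/-- There is a coercive Lyapunov-Krasovskii functional with exponential dissipation. -/
def HasCoerciveFunctional {n : ℕ} {r : ℝ} (p : ℝ≥0) (f : History n r → Vec n) : Prop :=
  ∃ (V : Sobolev n r p → ℝ≥0) (a₁ a₂ : ℝ≥0 → ℝ≥0),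
    FunctionalLipschitzOnBounded V ∧ ClassKInf a₁ ∧ ClassKInf a₂ ∧
    ∀ x : Sobolev n r p,
      a₁ (sobolevNorm p x.1) ≤ V x ∧ V x ≤ a₂ (sobolevNorm p x.1) ∧
      DiniAlongLE f V x (-(V x : ℝ))

/-- There is a (possibly non-coercive) Lyapunov-Krasovskii functional with pointwise
dissipation. -/
def HasPointwiseFunctional {n : ℕ} {r : ℝ} (hr : 0 < r) (p : ℝ≥0) (f : History n r → Vec n) :
    Prop :=
  ∃ (V : Sobolev n r p → ℝ≥0) (Q : Vec n → ℝ≥0) (a₁ a₂ : ℝ≥0 → ℝ≥0),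
    FunctionalLipschitzOnBounded V ∧ Continuous Q ∧ (∀ v, Q v = 0 ↔ v = 0) ∧
    ClassKInf a₁ ∧ ClassKInf a₂ ∧
    ∀ x : Sobolev n r p,
      a₁ ‖evalZero hr x.1‖₊ ≤ V x ∧ V x ≤ a₂ (sobolevNorm p x.1) ∧
      DiniAlongLE f V x (-(Q (evalZero hr x.1) : ℝ))

end DelaySystem

end

/-! ### Absolutely continuous vector-valued functions -/

section AbsolutelyContinuous

variable {E : Type*} [NormedAddCommGroup E] {F : ℝ → E} {a b : ℝ}

/-! Balls of `X` need not be compact in `X`, but Hölder estimates and Arzelà–Ascoli make them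
relatively compact in `C⁰`, and for `p > 1` uniform limits of bounded sequences stay in `X`
(`mem_sobolevSet_of_tendsto`). So every limit point is again an initial condition with a global
solution. The equation bridges the two topologies: once a time `r` has passed, the derivative of a
segment is given by `f` along the solution, so uniform smallness over a window yields smallness in
`X` (`IsSolution.sobolevNorm_histSegment_sub_le`). Continuous dependence in `C⁰` and compactness
therefore make attraction uniform on bounded sets of `X` (`exists_time_sobolevNorm_histSegment_le`),
and uniform attraction with stability gives a `KL` bound.

For the converse direction, take a weighted series over `q` of the suprema over `t` of `e^t
(‖φ(t,x)‖ - 1/(q+1))⁺`. On a bounded set the truncation confines each supremum to a bounded time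
interval, whatever the rate of convergence, so each term is Lipschitz there; the factor `e^t` gives
exponential dissipation (`IsAttractiveSemiflow.exists_lyapunov`).

A coercive functional dissipates pointwise with `Q = a₁(|·|)`. In the other direction, a pointwise
functional bounds `|x(t)|` through `a₁` and `a₂`. Then `x` is Lipschitz in time on `[0, ∞)`, so each
excursion away from zero costs a fixed amount of `V`, and `x(t) → 0`
(`eventually_norm_lt_of_decrease`). The smoothing effect turns this into convergence in `X`. -/

theorem AbsolutelyContinuousOnInterval.of_dist_le {G : ℝ → ℝ}
    (hG : AbsolutelyContinuousOnInterval G a b)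
    (h : ∀ s ∈ uIcc a b, ∀ t ∈ uIcc a b, dist (F s) (F t) ≤ dist (G s) (G t)) :
    AbsolutelyContinuousOnInterval F a b := by
  rw [absolutelyContinuousOnInterval_iff] at hG ⊢
  intro ε hε
  obtain ⟨δ, hδ, H⟩ := hG ε hε
  refine ⟨δ, hδ, fun I hI hlen => lt_of_le_of_lt (Finset.sum_le_sum fun i hi => ?_) (H I hI hlen)⟩
  exact h _ (hI.1 i hi).1 _ (hI.1 i hi).2

/-- Hölder's inequality for the integral of a function in `L^p` over a set of small measure. -/
theorem setLIntegral_enorm_le_eLpNorm_mul {μ : Measure ℝ} {p : ℝ≥0∞} (hp : 1 ≤ p)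
    {g : ℝ → E}
    (hg : AEStronglyMeasurable g μ) (S : Set ℝ) :
    ∫⁻ u in S, ‖g u‖ₑ ∂μ ≤ eLpNorm g p μ * μ S ^ (1 - 1 / p.toReal) := by
  rw [← eLpNorm_one_eq_lintegral_enorm]
  refine (eLpNorm_le_eLpNorm_mul_rpow_measure_univ hp hg.restrict).trans ?_
  simp only [ENNReal.toReal_one, div_one, Measure.restrict_apply_univ, one_div]
  gcongr
  exact Measure.restrict_le_self

variable [NormedSpace ℝ E] {g : ℝ → E}

/-- The primitive of `‖g‖` is a real absolutely continuous function whose increments dominate those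
of `F`. -/
theorem AbsolutelyContinuousOnInterval.of_sub_eq_integral (hg : IntervalIntegrable g volume a b)
    (hF : ∀ s ∈ uIcc a b, ∀ t ∈ uIcc a b, F t - F s = ∫ u in s..t, g u) :
    AbsolutelyContinuousOnInterval F a b := by
  refine (hg.norm.absolutelyContinuousOnInterval_intervalIntegral
    (left_mem_uIcc (a := a) (b := b))).of_dist_le fun s hs t ht => ?_
  have hint : ∀ c ∈ uIcc a b, IntervalIntegrable (fun u => ‖g u‖) volume a c := fun c hc =>
    hg.norm.mono_set (uIcc_subset_uIcc_left hc)
  rw [dist_comm, dist_eq_norm, hF s hs t ht, dist_comm, Real.dist_eq,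
    intervalIntegral.integral_interval_sub_left (hint t ht) (hint s hs)]
  exact intervalIntegral.norm_integral_le_abs_integral_norm

theorem ae_hasDerivAt_of_sub_eq_integral [CompleteSpace E] (hab : a ≤ b)
    (hg : IntervalIntegrable g volume a b)
    (hF : ∀ s ∈ Icc a b, ∀ t ∈ Icc a b, F t - F s = ∫ u in s..t, g u) :
    ∀ᵐ x, x ∈ Ioo a b → HasDerivAt F (g x) x := by
  filter_upwards [hg.ae_hasDerivAt_integral] with x hx hxI
  rw [uIcc_of_le hab] at hx
  have h1 := (hx (Ioo_subset_Icc_self hxI) a ⟨le_rfl, hab⟩).const_add (F a)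
  refine h1.congr_of_eventuallyEq ?_
  filter_upwards [Ioo_mem_nhds hxI.1 hxI.2] with y hy
  rw [← hF a ⟨le_rfl, hab⟩ y (Ioo_subset_Icc_self hy)]
  abel

/-- `F` minus the primitive of its derivative is absolutely continuous with derivative zero almost
everywhere, hence constant. Finite dimension supplies differentiability almost everywhere. -/
theorem AbsolutelyContinuousOnInterval.sub_eq_integral_deriv [FiniteDimensional ℝ E] (hab : a ≤ b)
    (hF : AbsolutelyContinuousOnInterval F a b) (hd : IntervalIntegrable (deriv F) volume a b) :
    ∀ s ∈ Icc a b, ∀ t ∈ Icc a b, F t - F s = ∫ u in s..t, deriv F u := by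
  have : CompleteSpace E := FiniteDimensional.complete ℝ E
  have hint : ∀ c ∈ uIcc a b, IntervalIntegrable (deriv F) volume a c := fun c hc =>
    hd.mono_set (uIcc_subset_uIcc_left hc)
  have hI : AbsolutelyContinuousOnInterval (fun x => ∫ u in a..x, deriv F u) a b := by
    refine .of_sub_eq_integral hd fun s hs t ht => ?_
    exact intervalIntegral.integral_interval_sub_left (hint t ht) (hint s hs)
  obtain ⟨C, hC⟩ := (hF.sub hI).const_of_ae_hasDerivAt_zero (by
    filter_upwards [hF.boundedVariationOn.ae_differentiableAt_of_mem_uIcc,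
      hd.ae_hasDerivAt_integral] with x h1 h2 hx
    simpa using (h1 hx).hasDerivAt.sub (h2 hx a left_mem_uIcc))
  intro s hs t ht
  rw [← uIcc_of_le hab] at hs ht
  have h1 := hC s hs
  have h2 := hC t ht
  simp only [Pi.sub_apply] at h1 h2
  rw [← intervalIntegral.integral_interval_sub_left (hint t ht) (hint s hs)]
  rw [sub_eq_sub_iff_sub_eq_sub, h2, h1]

theorem enorm_intervalIntegral_le_lintegral (s t : ℝ) :
    ‖∫ u in s..t, g u‖ₑ ≤ ∫⁻ u in uIoc s t, ‖g u‖ₑ := by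
  rw [enorm_eq_iff_norm_eq.2 (intervalIntegral.norm_intervalIntegral_eq g s t volume)]
  exact enorm_integral_le_lintegral_enorm g

end AbsolutelyContinuous

namespace DelaySystem

variable {n : ℕ} {r : ℝ} {p : ℝ≥0}

/-! ### Densities of Sobolev functions -/

theorem extendZero_coe (x : History n r) (s : Icc (-r) (0 : ℝ)) : extendZero x s = x s :=
  Subtype.val_injective.extend_apply _ _ _

theorem extendZero_apply (x : History n r) {s : ℝ} (hs : s ∈ Icc (-r) (0 : ℝ)) :
    extendZero x s = x ⟨s, hs⟩ :=
  extendZero_coe x ⟨s, hs⟩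

theorem extendZero_sub (x y : History n r) : extendZero (x - y) = extendZero x - extendZero y := by
  ext1 s
  by_cases hs : s ∈ Icc (-r) (0 : ℝ)
  · simp [extendZero_apply _ hs]
  · have : ¬ ∃ a : Icc (-r) (0 : ℝ), (a : ℝ) = s := fun ⟨a, ha⟩ => hs (ha ▸ a.2)
    simp [extendZero, Function.extend_apply' _ _ _ this]

/-- `x` is the indefinite integral of a function `g` in `L^p(-r, 0)`. -/
structure HasDensity (p : ℝ≥0) (x : History n r) (g : ℝ → Vec n) : Prop where
  memLp : MemLp g p (volume.restrict (Ioo (-r) 0))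
  sub_eq : ∀ s ∈ Icc (-r) (0 : ℝ), ∀ t ∈ Icc (-r) (0 : ℝ),
    extendZero x t - extendZero x s = ∫ u in s..t, g u

theorem intervalIntegrable_of_memLp (hr : 0 < r) (hp : 1 < p) {g : ℝ → Vec n}
    (hg : MemLp g p (volume.restrict (Ioo (-r) 0))) : IntervalIntegrable g volume (-r) 0 := by
  rw [intervalIntegrable_iff_integrableOn_Ioo_of_le (by linarith)]
  exact hg.integrable (by exact_mod_cast hp.le)

theorem HasDensity.intervalIntegrable (hr : 0 < r) (hp : 1 < p) {x : History n r} {g : ℝ → Vec n}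
    (h : HasDensity p x g) : IntervalIntegrable g volume (-r) 0 :=
  intervalIntegrable_of_memLp hr hp h.memLp

theorem hasDensity_deriv (hr : 0 < r) (hp : 1 < p) {x : History n r} (hx : x ∈ sobolevSet n r p) :
    HasDensity p x (deriv (extendZero x)) :=
  ⟨hx.2, hx.1.sub_eq_integral_deriv (by linarith) (intervalIntegrable_of_memLp hr hp hx.2)⟩

theorem HasDensity.deriv_ae_eq (hr : 0 < r) (hp : 1 < p) {x : History n r} {g : ℝ → Vec n}
    (h : HasDensity p x g) :
    deriv (extendZero x) =ᵐ[volume.restrict (Ioo (-r) 0)] g := by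
  rw [EventuallyEq, ae_restrict_iff' measurableSet_Ioo]
  filter_upwards [ae_hasDerivAt_of_sub_eq_integral (by linarith) (h.intervalIntegrable hr hp)
    h.sub_eq] with s hs hsI
  exact (hs hsI).deriv

theorem HasDensity.mem_sobolevSet (hr : 0 < r) (hp : 1 < p) {x : History n r} {g : ℝ → Vec n}
    (h : HasDensity p x g) : x ∈ sobolevSet n r p := by
  refine ⟨.of_sub_eq_integral (h.intervalIntegrable hr hp) ?_,
    (memLp_congr_ae (h.deriv_ae_eq hr hp)).2 h.memLp⟩
  rw [uIcc_of_le (by linarith)]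
  exact h.sub_eq

/-- Lets the norm of a solution segment be computed from an explicit density instead of `deriv
(extendZero x)`. -/
theorem HasDensity.sobolevNorm_eq (hr : 0 < r) (hp : 1 < p) {x : History n r} {g : ℝ → Vec n}
    (h : HasDensity p x g) :
    sobolevNorm p x = ‖x‖₊ + (eLpNorm g p (volume.restrict (Ioo (-r) 0))).toNNReal := by
  rw [sobolevNorm, eLpNorm_congr_ae (h.deriv_ae_eq hr hp)]

theorem HasDensity.sub (hr : 0 < r) (hp : 1 < p) {x y : History n r} {g k : ℝ → Vec n}
    (hx : HasDensity p x g) (hy : HasDensity p y k) : HasDensity p (x - y) (g - k) := by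
  refine ⟨hx.memLp.sub hy.memLp, fun s hs t ht => ?_⟩
  have hsub : uIcc s t ⊆ uIcc (-r) 0 := by
    rw [uIcc_of_le (by linarith : -r ≤ 0)]; exact uIcc_subset_Icc hs ht
  have := intervalIntegral.integral_sub ((hx.intervalIntegrable hr hp).mono_set hsub)
    ((hy.intervalIntegrable hr hp).mono_set hsub)
  simp only [Pi.sub_apply, extendZero_sub]
  rw [this, ← hx.sub_eq s hs t ht, ← hy.sub_eq s hs t ht]
  abel

theorem hasDensity_zero : HasDensity p (0 : History n r) 0 := by
  refine ⟨MemLp.zero, fun s hs t ht => ?_⟩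
  simp [extendZero_apply _ hs, extendZero_apply _ ht]

theorem zero_mem_sobolevSet (hr : 0 < r) (hp : 1 < p) : (0 : History n r) ∈ sobolevSet n r p :=
  hasDensity_zero.mem_sobolevSet hr hp

theorem sobolevNorm_zero (hr : 0 < r) (hp : 1 < p) : sobolevNorm p (0 : History n r) = 0 := by
  simp [(hasDensity_zero (n := n) (r := r) (p := p)).sobolevNorm_eq hr hp]

theorem nnnorm_le_sobolevNorm (x : History n r) : ‖x‖₊ ≤ sobolevNorm p x :=
  le_self_add

theorem norm_le_sobolevNorm (x : History n r) : ‖x‖ ≤ sobolevNorm p x :=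
  nnnorm_le_sobolevNorm x

theorem eLpNorm_deriv_le_sobolevNorm {x : History n r} (hx : x ∈ sobolevSet n r p) :
    eLpNorm (deriv (extendZero x)) p (volume.restrict (Ioo (-r) 0)) ≤ sobolevNorm p x := by
  rw [← ENNReal.coe_toNNReal hx.2.eLpNorm_lt_top.ne]
  exact_mod_cast le_add_self

theorem sobolevNorm_le_add_sub (hr : 0 < r) (hp : 1 < p) {x y : History n r}
    (hx : x ∈ sobolevSet n r p) (hy : y ∈ sobolevSet n r p) :
    sobolevNorm p x ≤ sobolevNorm p y + sobolevNorm p (x - y) := by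
  have hdx := hasDensity_deriv hr hp hx
  have hdy := hasDensity_deriv hr hp hy
  have hd := hdx.sub hr hp hdy
  rw [hdx.sobolevNorm_eq hr hp, hdy.sobolevNorm_eq hr hp, hd.sobolevNorm_eq hr hp,
    add_add_add_comm]
  refine add_le_add ?_ ?_
  · simpa [add_comm] using nnnorm_add_le y (x - y)
  · rw [← ENNReal.toNNReal_add hdy.memLp.eLpNorm_lt_top.ne hd.memLp.eLpNorm_lt_top.ne]
    refine ENNReal.toNNReal_mono
      (ENNReal.add_ne_top.2 ⟨hdy.memLp.eLpNorm_lt_top.ne, hd.memLp.eLpNorm_lt_top.ne⟩) ?_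
    simpa using eLpNorm_add_le hdy.memLp.1 hd.memLp.1 (by exact_mod_cast hp.le)

theorem sobolevNorm_sub_comm (hr : 0 < r) (hp : 1 < p) {x y : History n r}
    (hx : x ∈ sobolevSet n r p) (hy : y ∈ sobolevSet n r p) :
    sobolevNorm p (x - y) = sobolevNorm p (y - x) := by
  have hdx := hasDensity_deriv hr hp hx
  have hdy := hasDensity_deriv hr hp hy
  rw [(hdx.sub hr hp hdy).sobolevNorm_eq hr hp, (hdy.sub hr hp hdx).sobolevNorm_eq hr hp,
    eLpNorm_sub_comm, ← nnnorm_neg, neg_sub]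

end DelaySystem

/-- Minkowski's inequality for the moving integral `s ↦ ∫ u in s..s+h, G u`. -/
theorem lintegral_rpow_setLIntegral_Ioc_le {G : ℝ → ℝ≥0∞} (hG : Measurable G) {q : ℝ} (hq : 1 < q)
    {h : ℝ} (hh : 0 < h) :
    ∫⁻ s, (∫⁻ u in Ioc s (s + h), G u) ^ q ≤ ENNReal.ofReal h ^ q * ∫⁻ u, G u ^ q := by
  have hvol : ENNReal.ofReal h ≠ 0 := by simpa using hh
  have hshift : ∀ (F : ℝ → ℝ≥0∞) (s : ℝ),
      ∫⁻ u in Ioc s (s + h), F u = ∫⁻ v in Ioc 0 h, F (s + v) := by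
    intro F s
    rw [← (measurePreserving_add_left volume s).setLIntegral_comp_preimage_emb
      (MeasurableEquiv.addLeft s).measurableEmbedding F]
    simp
  -- Hölder against the constant `1` on an interval of length `h`. Tonelli and translation
  -- invariance then supply the remaining factor `h`.
  have hJ : ∀ s, (∫⁻ u in Ioc s (s + h), G u) ^ q ≤
      ENNReal.ofReal h ^ (q - 1) * ∫⁻ v in Ioc 0 h, G (s + v) ^ q := by
    intro s
    have hc : q.HolderConjugate (q / (q - 1)) := Real.HolderConjugate.conjExponent hq
    have := ENNReal.lintegral_mul_le_Lp_mul_Lq (volume.restrict (Ioc s (s + h))) hc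
      hG.aemeasurable (aemeasurable_const (b := (1 : ℝ≥0∞)))
    simp only [Pi.mul_apply, mul_one, ENNReal.one_rpow, lintegral_const,
      Measure.restrict_apply_univ, Real.volume_Ioc, add_sub_cancel_left, one_mul] at this
    rw [hshift (fun u => G u ^ q) s] at this
    calc _ ≤ ((∫⁻ v in Ioc 0 h, G (s + v) ^ q) ^ (1 / q) *
          ENNReal.ofReal h ^ (1 / (q / (q - 1)))) ^ q := by gcongr
      _ = _ := by
        rw [ENNReal.mul_rpow_of_nonneg _ _ (by linarith), ← ENNReal.rpow_mul, ← ENNReal.rpow_mul,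
          one_div_mul_cancel (by linarith), ENNReal.rpow_one, mul_comm]
        congr 2
        have : q ≠ 0 := by linarith
        field_simp
  calc _ ≤ ∫⁻ s, ENNReal.ofReal h ^ (q - 1) * ∫⁻ v in Ioc 0 h, G (s + v) ^ q :=
        lintegral_mono hJ
    _ = ENNReal.ofReal h ^ (q - 1) * ∫⁻ v in Ioc 0 h, ∫⁻ s, G (s + v) ^ q := by
      rw [lintegral_const_mul' _ _ (ENNReal.rpow_ne_top_of_nonneg (by linarith) ENNReal.ofReal_ne_top),
        lintegral_lintegral_swap]
      exact ((hG.comp (measurable_fst.add measurable_snd)).pow_const q).aemeasurable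
    _ = ENNReal.ofReal h ^ (q - 1) * (ENNReal.ofReal h * ∫⁻ u, G u ^ q) := by
      congr 1
      simp_rw [lintegral_add_right_eq_self (fun s => G s ^ q)]
      simp [mul_comm]
    _ = _ := by
      rw [← mul_assoc]
      congr 1
      nth_rw 2 [← ENNReal.rpow_one (ENNReal.ofReal h)]
      rw [← ENNReal.rpow_add _ _ hvol ENNReal.ofReal_ne_top]
      simp

namespace DelaySystem

variable {n : ℕ} {r : ℝ} {p : ℝ≥0}

theorem measurable_extendZero (hr : 0 < r) (x : History n r) : Measurable (extendZero x) := by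
  have : extendZero x = indicator (Icc (-r) 0) (IccExtend (by linarith : -r ≤ 0) x) := by
    ext1 s
    by_cases hs : s ∈ Icc (-r) (0 : ℝ)
    · rw [extendZero_apply x hs, indicator_of_mem hs, IccExtend_of_mem _ _ hs]
    · have h : ¬ ∃ a : Icc (-r) (0 : ℝ), (a : ℝ) = s := fun ⟨a, ha⟩ => hs (ha ▸ a.2)
      rw [indicator_of_notMem hs, extendZero, Function.extend_apply' _ _ _ h]; rfl
  rw [this]
  exact (x.continuous.Icc_extend' (h := by linarith)).measurable.indicator measurableSet_Icc

theorem tendsto_extendZero {u : ℕ → History n r} {x : History n r} (hu : Tendsto u atTop (𝓝 x))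
    (s : ℝ) : Tendsto (fun k => extendZero (u k) s) atTop (𝓝 (extendZero x s)) := by
  by_cases hs : s ∈ Icc (-r) (0 : ℝ)
  · simp only [extendZero_apply _ hs]
    exact ((ContinuousEvalConst.continuous_eval_const (⟨s, hs⟩ : Icc (-r) (0 : ℝ))).tendsto x).comp hu
  · have h : ¬ ∃ a : Icc (-r) (0 : ℝ), (a : ℝ) = s := fun ⟨a, ha⟩ => hs (ha ▸ a.2)
    simp [extendZero, Function.extend_apply' _ _ _ h]

theorem one_sub_one_div_pos (hp : 1 < p) : 0 < 1 - 1 / (p : ℝ) := by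
  have h : (1 : ℝ) < p := by exact_mod_cast hp
  rw [sub_pos, div_lt_one (by linarith)]
  exact h

theorem restrict_Ioo_apply_le (S : Set ℝ) :
    volume.restrict (Ioo (-r) 0) S ≤ volume S := Measure.restrict_le_self S

theorem edist_extendZero_le {x : History n r} (hr : 0 < r) (hp : 1 < p)
    (hx : x ∈ sobolevSet n r p) {s t : ℝ} (hs : s ∈ Icc (-r) (0 : ℝ)) (ht : t ∈ Icc (-r) (0 : ℝ)) :
    edist (extendZero x s) (extendZero x t) ≤
      ∫⁻ u in uIoc s t, ‖deriv (extendZero x) u‖ₑ ∂(volume.restrict (Ioo (-r) 0)) := by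
  rw [edist_comm, edist_eq_enorm_sub, (hasDensity_deriv hr hp hx).sub_eq s hs t ht]
  refine (enorm_intervalIntegral_le_lintegral s t).trans (le_of_eq ?_)
  have hsub : uIoc s t ⊆ Ioc (-r) 0 := by
    rw [← uIoc_of_le (by linarith : -r ≤ 0)]
    intro u hu
    simp only [mem_uIoc, mem_Icc] at hu hs ht ⊢
    rcases hu with hu | hu
    · left; constructor <;> linarith
    · left; constructor <;> linarith
  rw [restrict_Ioo_eq_restrict_Ioc, Measure.restrict_restrict measurableSet_uIoc,
    inter_eq_left.2 hsub]

theorem edist_extendZero_le_rpow {x : History n r} (hr : 0 < r) (hp : 1 < p)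
    (hx : x ∈ sobolevSet n r p) {s t : ℝ} (hs : s ∈ Icc (-r) (0 : ℝ)) (ht : t ∈ Icc (-r) (0 : ℝ)) :
    edist (extendZero x s) (extendZero x t) ≤
      sobolevNorm p x * edist s t ^ (1 - 1 / (p : ℝ)) := by
  refine (edist_extendZero_le hr hp hx hs ht).trans ?_
  refine (setLIntegral_enorm_le_eLpNorm_mul (p := p) (by exact_mod_cast hp.le)
    (aestronglyMeasurable_deriv _ _) _).trans ?_
  have := (one_sub_one_div_pos hp).le
  refine mul_le_mul' (eLpNorm_deriv_le_sobolevNorm hx) ?_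
  simp only [ENNReal.coe_toReal]
  refine ENNReal.rpow_le_rpow ((restrict_Ioo_apply_le _).trans ?_) this
  rw [edist_comm, edist_dist, Real.dist_eq]
  simp [uIoc, max_sub_min_eq_abs]

theorem holderWith_of_mem_sobolevSet {x : History n r} (hr : 0 < r) (hp : 1 < p)
    (hx : x ∈ sobolevSet n r p) : HolderWith (sobolevNorm p x) (1 - 1 / p) x := by
  intro s t
  have h := edist_extendZero_le_rpow hr hp hx s.2 t.2
  rw [extendZero_coe, extendZero_coe] at h
  convert h using 2
  have : 1 / p ≤ 1 := by rw [div_le_one (by positivity)]; exact hp.le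
  rw [NNReal.coe_sub this]; simp [Subtype.edist_eq]

theorem sobolevSet_subset_holderSet (hr : 0 < r) (hp : 1 < p) :
    sobolevSet n r p ⊆ holderSet n r (1 - 1 / p) :=
  fun _ hx => ⟨_, holderWith_of_mem_sobolevSet hr hp hx⟩

/-- Hölder is applied once, on the union of the disjoint intervals. The bound involves `x` only
through finitely many values and its Sobolev norm, so it survives uniform limits of bounded
sequences. -/
theorem sum_edist_extendZero_le {x : History n r} (hr : 0 < r) (hp : 1 < p)
    (hx : x ∈ sobolevSet n r p) {I : ℕ × (ℕ → ℝ × ℝ)}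
    (hI : I ∈ AbsolutelyContinuousOnInterval.disjWithin (-r) 0) :
    ∑ i ∈ Finset.range I.1, edist (extendZero x (I.2 i).1) (extendZero x (I.2 i).2) ≤
      sobolevNorm p x *
        ENNReal.ofReal (∑ i ∈ Finset.range I.1, dist (I.2 i).1 (I.2 i).2) ^ (1 - 1 / (p : ℝ)) := by
  have hI1 := hI.1
  rw [uIcc_of_le (by linarith : -r ≤ 0)] at hI1
  calc _ ≤ ∑ i ∈ Finset.range I.1, ∫⁻ u in uIoc (I.2 i).1 (I.2 i).2,
        ‖deriv (extendZero x) u‖ₑ ∂(volume.restrict (Ioo (-r) 0)) :=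
        Finset.sum_le_sum fun i hi => edist_extendZero_le hr hp hx (hI1 i hi).1 (hI1 i hi).2
    _ = ∫⁻ u in ⋃ i ∈ Finset.range I.1, uIoc (I.2 i).1 (I.2 i).2,
        ‖deriv (extendZero x) u‖ₑ ∂(volume.restrict (Ioo (-r) 0)) :=
      (lintegral_biUnion_finset hI.2 (fun _ _ => measurableSet_uIoc) _).symm
    _ ≤ _ := by
      refine (setLIntegral_enorm_le_eLpNorm_mul (p := p) (by exact_mod_cast hp.le)
        (aestronglyMeasurable_deriv _ _) _).trans ?_
      refine mul_le_mul' (eLpNorm_deriv_le_sobolevNorm hx) ?_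
      simp only [ENNReal.coe_toReal]
      refine ENNReal.rpow_le_rpow ((restrict_Ioo_apply_le _).trans ?_) (one_sub_one_div_pos hp).le
      refine (measure_biUnion_finset_le _ _).trans ?_
      rw [ENNReal.ofReal_sum_of_nonneg fun _ _ => dist_nonneg]
      refine Finset.sum_le_sum fun i _ => ?_
      simp [uIoc, Real.dist_eq, max_sub_min_eq_abs']

/-- The difference quotient of `x` with step `h`, cut off to the interval where it makes sense. -/
noncomputable def diffQuotient (x : History n r) (h s : ℝ) : Vec n :=
  indicator (Ioo (-r) (-h)) (fun s => h⁻¹ • (extendZero x (s + h) - extendZero x s)) s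

theorem measurable_diffQuotient (hr : 0 < r) (x : History n r) (h : ℝ) :
    Measurable (diffQuotient x h) := by
  have hm := measurable_extendZero hr x
  exact (((hm.comp (measurable_id.add_const h)).sub hm).const_smul h⁻¹).indicator measurableSet_Ioo

/-- Pointwise, the difference quotient is at most the average of `‖ẋ‖` over `[s, s + h]`, and
averaging does not increase the `L^p` norm. The bound is uniform in `h`. -/
theorem eLpNorm_diffQuotient_le (hr : 0 < r) (hp : 1 < p) {x : History n r}
    (hx : x ∈ sobolevSet n r p) {h : ℝ} (hh : 0 < h) :
    eLpNorm (diffQuotient x h) p volume ≤ sobolevNorm p x := by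
  set g := indicator (Ioo (-r) 0) (deriv (extendZero x)) with hg
  have hgm : Measurable g := (measurable_deriv _).indicator measurableSet_Ioo
  have hp' : (1 : ℝ) < p := by exact_mod_cast hp
  have hp0 : (p : ℝ≥0∞) ≠ 0 := by simpa using (by positivity : p ≠ 0)
  refine le_trans ?_ (eLpNorm_deriv_le_sobolevNorm hx)
  rw [← eLpNorm_indicator_eq_eLpNorm_restrict measurableSet_Ioo, ← hg]
  have hpt : ∀ s, ‖diffQuotient x h s‖ₑ ≤
      (ENNReal.ofReal h)⁻¹ * ∫⁻ u in Ioc s (s + h), ‖g u‖ₑ := by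
    intro s
    by_cases hs : s ∈ Ioo (-r) (-h)
    · rw [diffQuotient, indicator_of_mem hs, enorm_smul, ← edist_eq_enorm_sub, edist_comm,
        Real.enorm_eq_ofReal (by positivity), ENNReal.ofReal_inv_of_pos hh]
      gcongr
      refine (edist_extendZero_le hr hp hx ⟨hs.1.le, by linarith [hs.2]⟩
        ⟨by linarith [hs.1], by linarith [hs.2]⟩).trans (le_of_eq ?_)
      rw [Measure.restrict_restrict measurableSet_uIoc, uIoc_of_le (by linarith), inter_comm,
        ← Measure.restrict_restrict measurableSet_Ioo, ← lintegral_indicator measurableSet_Ioo]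
      refine lintegral_congr fun u => ?_
      rw [hg, enorm_indicator_eq_indicator_enorm]
    · rw [diffQuotient, indicator_of_notMem hs]; simp
  rw [eLpNorm_eq_lintegral_rpow_enorm_toReal hp0 ENNReal.coe_ne_top,
    eLpNorm_eq_lintegral_rpow_enorm_toReal hp0 ENNReal.coe_ne_top]
  simp only [ENNReal.coe_toReal]
  have hh0 : ENNReal.ofReal h ≠ 0 := by simpa using hh
  gcongr ?_ ^ _
  calc _ ≤ ∫⁻ s, (ENNReal.ofReal h)⁻¹ ^ (p : ℝ) * (∫⁻ u in Ioc s (s + h), ‖g u‖ₑ) ^ (p : ℝ) := by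
        refine lintegral_mono fun s => ?_
        rw [← ENNReal.mul_rpow_of_nonneg _ _ (by linarith)]
        exact ENNReal.rpow_le_rpow (hpt s) (by linarith)
    _ = (ENNReal.ofReal h)⁻¹ ^ (p : ℝ) * ∫⁻ s, (∫⁻ u in Ioc s (s + h), ‖g u‖ₑ) ^ (p : ℝ) :=
      lintegral_const_mul' _ _ (ENNReal.rpow_ne_top_of_nonneg (by linarith) (by simpa using hh))
    _ ≤ (ENNReal.ofReal h)⁻¹ ^ (p : ℝ) *
        (ENNReal.ofReal h ^ (p : ℝ) * ∫⁻ u, ‖g u‖ₑ ^ (p : ℝ)) := by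
      gcongr
      exact lintegral_rpow_setLIntegral_Ioc_le hgm.enorm hp' hh
    _ = _ := by
      rw [← mul_assoc, ← ENNReal.mul_rpow_of_nonneg _ _ (by linarith),
        ENNReal.inv_mul_cancel hh0 ENNReal.ofReal_ne_top, ENNReal.one_rpow, one_mul]

theorem tendsto_diffQuotient {x : History n r} {s : ℝ} (hs : s ∈ Ioo (-r) 0)
    (hd : DifferentiableAt ℝ (extendZero x) s) :
    Tendsto (fun k : ℕ => diffQuotient x (1 / ((k : ℝ) + 1)) s) atTop
      (𝓝 (deriv (extendZero x) s)) := by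
  have h0 : Tendsto (fun k : ℕ => 1 / ((k : ℝ) + 1)) atTop (𝓝 0) :=
    tendsto_one_div_add_atTop_nhds_zero_nat
  have h1 : Tendsto (fun k : ℕ => 1 / ((k : ℝ) + 1)) atTop (𝓝[≠] 0) :=
    tendsto_nhdsWithin_iff.2 ⟨h0, .of_forall fun k => by
      simpa using (by positivity : (k : ℝ) + 1 ≠ 0)⟩
  refine (hd.hasDerivAt.tendsto_slope_zero.comp h1).congr' ?_
  filter_upwards [h0.eventually_lt_const (by linarith [hs.2] : 0 < -s)] with k hk
  have hmem : s ∈ Ioo (-r) (-(1 / ((k : ℝ) + 1))) := ⟨hs.1, by linarith⟩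
  rw [diffQuotient, indicator_of_mem hmem]
  rfl

/-- Uniform limits of bounded sequences in `W^{1,p}`, `p > 1`, belong to `W^{1,p}`. -/
theorem mem_sobolevSet_of_tendsto (hr : 0 < r) (hp : 1 < p) {R : ℝ≥0} {u : ℕ → History n r}
    {x : History n r} (hu : ∀ k, u k ∈ sobolevSet n r p) (hR : ∀ k, sobolevNorm p (u k) ≤ R)
    (hlim : Tendsto u atTop (𝓝 x)) : x ∈ sobolevSet n r p := by
  have hα := one_sub_one_div_pos hp
  have hac : AbsolutelyContinuousOnInterval (extendZero x) (-r) 0 := by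
    have hle : ∀ I ∈ AbsolutelyContinuousOnInterval.disjWithin (-r) 0,
        ∑ i ∈ Finset.range I.1, edist (extendZero x (I.2 i).1) (extendZero x (I.2 i).2) ≤
      R * ENNReal.ofReal (∑ i ∈ Finset.range I.1, dist (I.2 i).1 (I.2 i).2) ^
        (1 - 1 / (p : ℝ)) := by
      intro I hI
      refine le_of_tendsto (tendsto_finsetSum _ fun i _ =>
        (tendsto_extendZero hlim _).edist (tendsto_extendZero hlim _)) (.of_forall fun k => ?_)
      refine (sum_edist_extendZero_le hr hp (hu k) hI).trans ?_
      gcongr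
      exact hR k
    rw [absolutelyContinuousOnInterval_iff]
    intro ε hε
    have hlim0 : Tendsto (fun d : ℝ => (R : ℝ≥0∞) * ENNReal.ofReal d ^ (1 - 1 / (p : ℝ)))
        (𝓝 0) (𝓝 0) := by
      have : Tendsto (fun d : ℝ => ENNReal.ofReal d ^ (1 - 1 / (p : ℝ))) (𝓝 0) (𝓝 0) := by
        have := (ENNReal.continuous_rpow_const (y := 1 - 1 / (p : ℝ))).comp
          ENNReal.continuous_ofReal |>.tendsto 0
        simpa [ENNReal.zero_rpow_of_pos hα, Function.comp_def, -one_div] using this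
      simpa using ENNReal.Tendsto.const_mul this (Or.inr ENNReal.coe_ne_top)
    obtain ⟨δ, hδ, hδ'⟩ := Metric.eventually_nhds_iff.1
      (hlim0.eventually_lt_const (by simpa using hε : 0 < ENNReal.ofReal ε))
    refine ⟨δ, hδ, fun I hI hlen => ?_⟩
    have hnn : 0 ≤ ∑ i ∈ Finset.range I.1, dist (I.2 i).1 (I.2 i).2 :=
      Finset.sum_nonneg fun _ _ => dist_nonneg
    have := (hle I hI).trans_lt (hδ' (by rwa [Real.dist_eq, sub_zero, abs_of_nonneg hnn]))
    simp only [edist_dist] at this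
    rw [← ENNReal.ofReal_sum_of_nonneg fun _ _ => dist_nonneg] at this
    exact (ENNReal.ofReal_lt_ofReal_iff hε).1 this
  refine ⟨hac, aestronglyMeasurable_deriv _ _, ?_⟩
  -- Fatou's lemma along the sequence, for a fixed step: difference quotients pass to uniform
  -- limits, while derivatives need not.
  have hdq : ∀ h : ℝ, 0 < h → eLpNorm (diffQuotient x h) p volume ≤ R := by
    intro h hh
    refine (Lp.eLpNorm_lim_le_liminf_eLpNorm (f := fun k => diffQuotient (u k) h)
      (fun k => (measurable_diffQuotient hr _ h).aestronglyMeasurable) _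
      (.of_forall fun s => ?_)).trans ?_
    · by_cases hs : s ∈ Ioo (-r) (-h)
      · simp only [diffQuotient, indicator_of_mem hs]
        exact ((tendsto_extendZero hlim _).sub (tendsto_extendZero hlim _)).const_smul _
      · simp [diffQuotient, indicator_of_notMem hs]
    · refine (liminf_le_liminf (v := fun _ => (R : ℝ≥0∞)) (.of_forall fun k => ?_)).trans
        (by simp)
      exact (eLpNorm_diffQuotient_le hr hp (hu k) hh).trans (by exact_mod_cast hR k)
  -- Fatou's lemma again, now as the step tends to zero. The limit exists almost everywhere because
  -- `x` is already known to be absolutely continuous.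
  refine lt_of_le_of_lt ?_ (ENNReal.coe_lt_top (r := R))
  refine (Lp.eLpNorm_lim_le_liminf_eLpNorm
    (f := fun k : ℕ => diffQuotient x (1 / ((k : ℝ) + 1)))
    (fun k => (measurable_diffQuotient hr _ _).aestronglyMeasurable) _ ?_).trans ?_
  · rw [ae_restrict_iff' measurableSet_Ioo]
    filter_upwards [hac.boundedVariationOn.ae_differentiableAt_of_mem_uIcc] with s hs hsI
    refine tendsto_diffQuotient hsI (hs ?_)
    rw [uIcc_of_le (by linarith)]
    exact Ioo_subset_Icc_self hsI
  · refine (liminf_le_liminf (v := fun _ => (R : ℝ≥0∞)) (.of_forall fun k => ?_)).trans (by simp)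
    exact (eLpNorm_mono_measure _ Measure.restrict_le_self).trans (hdq _ (by positivity))

/-- The closed ball of radius `R` in `W^{1,p}`, as a set of continuous functions. -/
def sobolevBall (n : ℕ) (r : ℝ) (p R : ℝ≥0) : Set (History n r) :=
  {x ∈ sobolevSet n r p | sobolevNorm p x ≤ R}

/-- Makes forward completeness applicable at the limit points used in compactness arguments. For `p
= 1`, uniform limits may fail to be absolutely continuous. -/
theorem closure_sobolevBall_subset (hr : 0 < r) (hp : 1 < p) (R : ℝ≥0) :
    closure (sobolevBall n r p R) ⊆ sobolevSet n r p := by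
  intro x hx
  obtain ⟨u, hu, hlim⟩ := mem_closure_iff_seq_limit.1 hx
  exact mem_sobolevSet_of_tendsto hr hp (fun k => (hu k).1) (fun k => (hu k).2) hlim

/-- On the ball, `R` is a common Hölder constant and a common uniform bound, so Arzelà–Ascoli
applies after transport to bounded continuous functions. -/
theorem isCompact_closure_sobolevBall (hr : 0 < r) (hp : 1 < p) (R : ℝ≥0) :
    IsCompact (closure (sobolevBall n r p R)) := by
  let e := ContinuousMap.isometryEquivBoundedOfCompact (Icc (-r) (0 : ℝ)) (Vec n)
  have hα := one_sub_one_div_pos hp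
  have hA : IsCompact (closure (e '' sobolevBall n r p R)) := by
    refine BoundedContinuousFunction.arzela_ascoli (Metric.closedBall 0 R)
      (isCompact_closedBall _ _) _ ?_ ?_
    · rintro _ s ⟨x, hx, rfl⟩
      rw [mem_closedBall_zero_iff]
      exact (x.norm_coe_le_norm s).trans ((norm_le_sobolevNorm x).trans (by exact_mod_cast hx.2))
    · refine (Metric.uniformEquicontinuous_of_continuity_modulus
        (fun d => R * d ^ (1 - 1 / (p : ℝ))) ?_ _ ?_).equicontinuous
      · have := (Real.continuousAt_rpow_const 0 (1 - 1 / (p : ℝ)) (Or.inr hα.le)).tendsto.const_mul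
          (R : ℝ)
        rwa [Real.zero_rpow hα.ne', mul_zero] at this
      · rintro s t ⟨_, x, hx, rfl⟩
        have h := (holderWith_of_mem_sobolevSet hr hp hx.1).dist_le s t
        have h1 : 1 / p ≤ 1 := by rw [div_le_one (by positivity)]; exact hp.le
        rw [NNReal.coe_sub h1] at h
        refine h.trans ?_
        simp only [NNReal.coe_one, NNReal.coe_div]
        gcongr
        exact hx.2
  refine ((e.toHomeomorph.isCompact_preimage).2 hA).of_isClosed_subset isClosed_closure ?_
  refine closure_minimal (fun x hx => ?_) (isClosed_closure.preimage e.continuous)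
  exact subset_closure (mem_image_of_mem e hx)

variable {f : History n r → Vec n} {x₀ y₀ : History n r}
  {x y : C(ℝ, Vec n)}

/-! ### Solutions of the delay system -/

theorem RhsLipschitzOnBounded.exists_const (hf : RhsLipschitzOnBounded f) (M : ℝ) :
    ∃ C : ℝ, 0 ≤ C ∧ ∀ x y : History n r, ‖x‖ ≤ M → ‖y‖ ≤ M → ‖f x - f y‖ ≤ C * ‖x - y‖ := by
  obtain ⟨L, -, hL⟩ := hf
  exact ⟨L M.toNNReal, NNReal.coe_nonneg _, fun x y hx hy =>
    hL _ x y (hx.trans (Real.le_coe_toNNReal M)) (hy.trans (Real.le_coe_toNNReal M))⟩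

theorem RhsLipschitzOnBounded.continuous (hf : RhsLipschitzOnBounded f) : Continuous f := by
  rw [continuous_iff_continuousAt]
  intro x
  obtain ⟨C, -, hC⟩ := hf.exists_const (‖x‖ + 1)
  refine continuousAt_of_locally_lipschitz zero_lt_one C fun y hy => ?_
  rw [dist_eq_norm] at hy
  rw [dist_eq_norm, dist_eq_norm]
  refine hC y x ?_ (by linarith)
  linarith [norm_le_norm_add_norm_sub' y x]

theorem histSegment_apply (x : C(ℝ, Vec n)) (t : ℝ) (s : Icc (-r) (0 : ℝ)) :
    histSegment r x t s = x (t + s) := rfl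

theorem continuous_histSegment (r : ℝ) (x : C(ℝ, Vec n)) : Continuous (histSegment r x) :=
  (ContinuousMap.curry ⟨fun q : ℝ × Icc (-r) (0 : ℝ) => x (q.1 + q.2), by fun_prop⟩).continuous

theorem norm_histSegment_sub_le_iff {t C : ℝ} (hC : 0 ≤ C) :
    ‖histSegment r x t - histSegment r y t‖ ≤ C ↔
      ∀ u ∈ Icc (t - r) t, ‖x u - y u‖ ≤ C := by
  rw [ContinuousMap.norm_le _ hC]
  constructor
  · intro h u hu
    have := h ⟨u - t, by constructor <;> linarith [hu.1, hu.2]⟩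
    simpa [histSegment_apply] using this
  · intro h s
    exact h _ ⟨by linarith [s.2.1], by linarith [s.2.2]⟩

theorem norm_histSegment_le_iff {t C : ℝ} (hC : 0 ≤ C) :
    ‖histSegment r x t‖ ≤ C ↔ ∀ u ∈ Icc (t - r) t, ‖x u‖ ≤ C := by
  have := norm_histSegment_sub_le_iff (r := r) (x := x) (y := 0) (t := t) hC
  have h0 : histSegment r (0 : C(ℝ, Vec n)) t = 0 := rfl
  simpa [h0] using this

theorem norm_apply_le_histSegment {t u : ℝ} (hu : u ∈ Icc (t - r) t) :
    ‖x u‖ ≤ ‖histSegment r x t‖ :=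
  (norm_histSegment_le_iff (norm_nonneg _)).1 le_rfl u hu

theorem exists_norm_histSegment_le (r : ℝ) (x : C(ℝ, Vec n)) (T : ℝ) :
    ∃ M, 0 ≤ M ∧ ∀ t ∈ Icc 0 T, ‖histSegment r x t‖ ≤ M := by
  obtain ⟨M, hM⟩ := (isCompact_Icc (a := (0 : ℝ)) (b := T)).exists_bound_of_continuousOn
    (continuous_histSegment r x).continuousOn
  exact ⟨max M 0, le_max_right _ _, fun t ht => (hM t ht).trans (le_max_left _ _)⟩

/-- The time shift `t ↦ x (T + t)`. -/
def timeShift (T : ℝ) (x : C(ℝ, Vec n)) : C(ℝ, Vec n) := ⟨fun t => x (T + t), by fun_prop⟩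

theorem histSegment_timeShift (T t : ℝ) :
    histSegment r (timeShift T x) t = histSegment r x (T + t) := by
  ext1 s
  simp [histSegment_apply, timeShift, add_assoc]

theorem IsSolution.timeShift {T : ℝ} (hT : 0 ≤ T) (hx : IsSolution f x₀ x) :
    IsSolution f (histSegment r x T) (timeShift T x) := by
  refine ⟨by rw [histSegment_timeShift, add_zero], fun t ht => ?_⟩
  rw [histSegment_timeShift]
  have h := hx.hasDeriv (T + t) (by linarith)
  have h2 : HasDerivWithinAt (fun t : ℝ => T + t) 1 (Ici 0) t :=
    (hasDerivWithinAt_id t _).const_add T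
  have := h.scomp t h2 (fun s hs => by simp only [mem_Ici] at hs ⊢; linarith)
  rw [one_smul] at this
  exact this

theorem IsSolution.hasDerivWithinAt_Ici (hx : IsSolution f x₀ x) {t : ℝ} (ht : 0 ≤ t) :
    HasDerivWithinAt x (f (histSegment r x t)) (Ici t) t :=
  (hx.hasDeriv t ht).mono (Ici_subset_Ici.2 ht)

theorem isSolution_zero (hf0 : f 0 = 0) : IsSolution f 0 0 := by
  refine ⟨rfl, fun t _ => ?_⟩
  have h0 : histSegment r (0 : C(ℝ, Vec n)) t = 0 := rfl
  rw [h0, hf0]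
  exact hasDerivWithinAt_const t _ 0

/-- Gronwall's inequality for two solutions. The Lipschitz estimate is needed only as long as the
solutions stay within distance `D`, which the conclusion guarantees. -/
theorem IsSolution.norm_histSegment_sub_le (hr : 0 < r) (hx : IsSolution f x₀ x)
    (hy : IsSolution f y₀ y) {T L D d : ℝ} (hL : 0 ≤ L) (hd : ‖x₀ - y₀‖ < d)
    (hD : d * Real.exp (L * T) ≤ D)
    (hLip : ∀ t ∈ Icc 0 T, ‖histSegment r x t - histSegment r y t‖ ≤ D →
      ‖f (histSegment r x t) - f (histSegment r y t)‖ ≤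
        L * ‖histSegment r x t - histSegment r y t‖) :
    ∀ t ∈ Icc 0 T, ‖histSegment r x t - histSegment r y t‖ ≤ d * Real.exp (L * t) := by
  have hd0 : 0 < d := (norm_nonneg _).trans_lt hd
  have hneg : ∀ u ∈ Icc (-r) 0, ‖x u - y u‖ < d := by
    intro u hu
    refine lt_of_le_of_lt ?_ hd
    rw [← hx.initial, ← hy.initial]
    exact (norm_histSegment_sub_le_iff (norm_nonneg _)).1 le_rfl u (by simpa using hu)
  have hmono : ∀ {s t : ℝ}, s ≤ t → d * Real.exp (L * s) ≤ d * Real.exp (L * t) := by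
    intro s t hst; gcongr
  have hhist : ∀ t, 0 ≤ t → (∀ u ∈ Icc 0 t, ‖x u - y u‖ ≤ d * Real.exp (L * u)) →
      ‖histSegment r x t - histSegment r y t‖ ≤ d * Real.exp (L * t) := by
    intro t ht h
    rw [norm_histSegment_sub_le_iff (by positivity)]
    intro u hu
    rcases le_total 0 u with h0 | h0
    · exact (h u ⟨h0, hu.2⟩).trans (hmono hu.2)
    · refine (hneg u ⟨by linarith [hu.1], h0⟩).le.trans ?_
      simpa using hmono ht
  suffices hpt : ∀ t ∈ Icc 0 T, ‖x t - y t‖ < d * Real.exp (L * t) from fun t ht =>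
    hhist t ht.1 fun u hu => (hpt u ⟨hu.1, hu.2.trans ht.2⟩).le
  by_contra! hcon
  obtain ⟨t₁, ht₁, hbad⟩ := hcon
  have hclosed : IsCompact {t ∈ Icc 0 T | d * Real.exp (L * t) ≤ ‖x t - y t‖} :=
    isCompact_Icc.inter_right (isClosed_le
      (f := fun t => d * Real.exp (L * t)) (g := fun t => ‖x t - y t‖) (by fun_prop) (by fun_prop))
  -- The first failure time: before it the desired bound holds, so the solutions are within `D` and
  -- the Lipschitz estimate is available.
  obtain ⟨τ, ⟨hτ, hτbad⟩, hmin⟩ := hclosed.exists_isLeast ⟨t₁, ht₁, hbad⟩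
  have hgood : ∀ u ∈ Ico 0 τ, ‖x u - y u‖ ≤ d * Real.exp (L * u) := by
    intro u hu
    by_contra! h
    exact absurd (hmin ⟨⟨hu.1, hu.2.le.trans hτ.2⟩, h.le⟩) (not_le.2 hu.2)
  -- Starting the comparison function at `‖x 0 - y 0‖ < d` rather than at `d` leaves a strict gap at
  -- `τ`, which contradicts failure there.
  have hfence : ‖x τ - y τ‖ ≤ ‖x 0 - y 0‖ - d + d * Real.exp (L * τ) := by
    refine image_norm_le_of_norm_deriv_right_le_deriv_boundary'
      (f := fun s => x s - y s) (f' := fun s => f (histSegment r x s) - f (histSegment r y s))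
      (B := fun s => ‖x 0 - y 0‖ - d + d * Real.exp (L * s))
      (B' := fun s => L * (d * Real.exp (L * s))) (a := 0) (b := τ) (by fun_prop)
      (fun s hs => (hx.hasDerivWithinAt_Ici hs.1).sub (hy.hasDerivWithinAt_Ici hs.1)) (by simp)
      (by fun_prop) (fun s _ => ?_) (fun s hs => ?_) ⟨hτ.1, le_rfl⟩
    · have := ((((hasDerivAt_id s).const_mul L).exp.const_mul d).const_add
        (‖x 0 - y 0‖ - d)).hasDerivWithinAt (s := Ici s)
      refine this.congr_deriv ?_
      simp; ring
    · have h1 := hhist s hs.1 fun u hu => hgood u ⟨hu.1, hu.2.trans_lt hs.2⟩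
      have hsT : s ≤ T := hs.2.le.trans hτ.2
      exact (hLip s ⟨hs.1, hsT⟩ (h1.trans ((hmono hsT).trans hD))).trans (by gcongr)
  have := hneg 0 ⟨by linarith, le_rfl⟩
  linarith

theorem IsSolution.norm_histSegment_sub_le_of_bounded (hr : 0 < r) (hx : IsSolution f x₀ x)
    (hy : IsSolution f y₀ y) {T L M : ℝ} (hL : 0 ≤ L)
    (hLip : ∀ x y : History n r, ‖x‖ ≤ M → ‖y‖ ≤ M → ‖f x - f y‖ ≤ L * ‖x - y‖)
    (hxM : ∀ t ∈ Icc 0 T, ‖histSegment r x t‖ ≤ M)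
    (hyM : ∀ t ∈ Icc 0 T, ‖histSegment r y t‖ ≤ M) :
    ∀ t ∈ Icc 0 T, ‖histSegment r x t - histSegment r y t‖ ≤ Real.exp (L * T) * ‖x₀ - y₀‖ := by
  intro t ht
  rw [← div_le_iff₀' (Real.exp_pos _)]
  refine le_of_forall_gt_imp_ge_of_dense fun d hd => ?_
  rw [div_le_iff₀ (Real.exp_pos _)]
  have hd0 : 0 < d := (norm_nonneg _).trans_lt hd
  refine (hx.norm_histSegment_sub_le hr hy hL hd le_rfl
    (fun t ht _ => hLip _ _ (hxM t ht) (hyM t ht)) t ht).trans ?_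
  gcongr
  exact ht.2

theorem IsSolution.histSegment_eq (hr : 0 < r) (hf : RhsLipschitzOnBounded f)
    (hx : IsSolution f x₀ x) (hy : IsSolution f x₀ y) {t : ℝ} (ht : 0 ≤ t) :
    histSegment r x t = histSegment r y t := by
  obtain ⟨M, -, hM⟩ := exists_norm_histSegment_le r x t
  obtain ⟨M', -, hM'⟩ := exists_norm_histSegment_le r y t
  obtain ⟨L, hL, hLip⟩ := hf.exists_const (max M M')
  have := hx.norm_histSegment_sub_le_of_bounded hr hy hL hLip
    (fun s hs => (hM s hs).trans (le_max_left _ _))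
    (fun s hs => (hM' s hs).trans (le_max_right _ _)) t ⟨ht, le_rfl⟩
  rw [sub_self, norm_zero, mul_zero] at this
  exact sub_eq_zero.1 (norm_le_zero_iff.1 this)

/-- No a priori bound on `y` is needed: the Gronwall estimate itself keeps `y` within `η` of `x`, so
the Lipschitz constant on the ball of radius `M + η` suffices. -/
theorem IsSolution.exists_dist_le (hr : 0 < r) (hf : RhsLipschitzOnBounded f)
    (hx : IsSolution f x₀ x) (T : ℝ) {η : ℝ} (hη : 0 < η) :
    ∃ δ > 0, ∀ (y₀ : History n r) (y : C(ℝ, Vec n)), IsSolution f y₀ y → ‖y₀ - x₀‖ < δ →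
      ∀ t ∈ Icc 0 T, ‖histSegment r y t - histSegment r x t‖ ≤ η := by
  obtain ⟨M, -, hM⟩ := exists_norm_histSegment_le r x T
  obtain ⟨L, hL, hLip⟩ := hf.exists_const (M + η)
  refine ⟨η / Real.exp (L * T), by positivity, fun y₀ y hy hδ t ht => ?_⟩
  have hD : η / Real.exp (L * T) * Real.exp (L * T) = η := div_mul_cancel₀ _ (Real.exp_ne_zero _)
  refine (hy.norm_histSegment_sub_le hr hx hL hδ hD.le (fun s hs hsη => ?_) t ht).trans ?_
  · refine hLip _ _ ?_ ((hM s hs).trans (by linarith))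
    linarith [hM s hs, norm_le_norm_add_norm_sub' (histSegment r y s) (histSegment r x s)]
  · rw [← hD, hD]
    calc _ ≤ η / Real.exp (L * T) * Real.exp (L * T) := by gcongr; exact ht.2
      _ = η := hD

/-! ### The derivative of a solution -/

/-- The derivative of the solution `x` with initial condition `x₀`. -/
noncomputable def solutionDeriv (f : History n r → Vec n) (x₀ : History n r) (x : C(ℝ, Vec n))
    (u : ℝ) : Vec n :=
  if u < 0 then deriv (extendZero x₀) u else f (histSegment r x u)

theorem memLp_indicator_solutionDeriv (hf : RhsLipschitzOnBounded f)
    (hx₀ : x₀ ∈ sobolevSet n r p) (T : ℝ) :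
    MemLp (indicator (Ioo (-r) T) (solutionDeriv f x₀ x)) p volume := by
  have h1 : MemLp (indicator (Ioo (-r) 0) (deriv (extendZero x₀))) p volume :=
    (memLp_indicator_iff_restrict measurableSet_Ioo).2 hx₀.2
  have hcont : Continuous fun u => f (histSegment r x u) :=
    hf.continuous.comp (continuous_histSegment r x)
  have h2 : MemLp (indicator (Icc 0 T) (fun u => f (histSegment r x u))) p volume := by
    rw [memLp_indicator_iff_restrict measurableSet_Icc]
    obtain ⟨C, hC⟩ := (isCompact_Icc (a := (0 : ℝ)) (b := T)).exists_bound_of_continuousOn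
      hcont.continuousOn
    refine MemLp.of_bound hcont.aestronglyMeasurable C ?_
    exact (ae_restrict_iff' measurableSet_Icc).2 (.of_forall hC)
  have h3 := (h1.add h2).indicator (measurableSet_Ioo (a := -r) (b := T))
  refine h3.ae_eq (.of_forall fun u => ?_)
  by_cases hu : u ∈ Ioo (-r) T
  · simp only [indicator_of_mem hu, Pi.add_apply, solutionDeriv]
    split_ifs with h0
    · rw [indicator_of_mem (show u ∈ Ioo (-r) 0 from ⟨hu.1, h0⟩),
        indicator_of_notMem (fun h => absurd h.1 (not_le.2 h0)), add_zero]
    · rw [indicator_of_notMem (fun h => h0 h.2),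
        indicator_of_mem (show u ∈ Icc 0 T from ⟨not_lt.1 h0, hu.2.le⟩), zero_add]
  · simp only [indicator_of_notMem hu]

theorem intervalIntegrable_solutionDeriv (hp : 1 < p) (hf : RhsLipschitzOnBounded f)
    (hx₀ : x₀ ∈ sobolevSet n r p) {a b : ℝ} (ha : -r ≤ a) (hb : -r ≤ b) :
    IntervalIntegrable (solutionDeriv f x₀ x) volume a b := by
  have h := memLp_indicator_solutionDeriv (x := x) hf hx₀ (max a b)
  rw [memLp_indicator_iff_restrict measurableSet_Ioo] at h
  have h2 : IntervalIntegrable (solutionDeriv f x₀ x) volume (-r) (max a b) := by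
    rw [intervalIntegrable_iff_integrableOn_Ioo_of_le (ha.trans (le_max_left _ _))]
    exact h.integrable (by exact_mod_cast hp.le)
  refine h2.mono_set ?_
  rw [uIcc_of_le (ha.trans (le_max_left _ _))]
  exact uIcc_subset_Icc ⟨ha, le_max_left _ _⟩ ⟨hb, le_max_right _ _⟩

theorem IsSolution.apply_of_mem (hx : IsSolution f x₀ x) {u : ℝ} (hu : u ∈ Icc (-r) (0 : ℝ)) :
    x u = extendZero x₀ u := by
  rw [extendZero_apply _ hu, ← hx.initial, histSegment_apply, zero_add]

theorem IsSolution.sub_eq_integral (hr : 0 < r) (hp : 1 < p) (hf : RhsLipschitzOnBounded f)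
    (hx₀ : x₀ ∈ sobolevSet n r p) (hx : IsSolution f x₀ x) {a b : ℝ} (ha : -r ≤ a) (hb : -r ≤ b) :
    x b - x a = ∫ u in a..b, solutionDeriv f x₀ x u := by
  have key : ∀ c, -r ≤ c → x c - x 0 = ∫ u in (0 : ℝ)..c, solutionDeriv f x₀ x u := by
    intro c hc
    rcases le_total 0 c with h0 | h0
    · have h1 : ∫ u in (0 : ℝ)..c, solutionDeriv f x₀ x u =
          ∫ u in (0 : ℝ)..c, f (histSegment r x u) := by
        refine intervalIntegral.integral_congr fun u hu => ?_
        rw [uIcc_of_le h0] at hu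
        simp [solutionDeriv, not_lt.2 hu.1]
      rw [h1]
      refine (intervalIntegral.integral_eq_sub_of_hasDeriv_right x.continuous.continuousOn
        (fun u hu => ?_) ?_).symm
      · rw [min_eq_left h0] at hu
        exact (hx.hasDerivWithinAt_Ici hu.1.le).mono Ioi_subset_Ici_self
      · exact (hf.continuous.comp (continuous_histSegment r x)).intervalIntegrable _ _
    · rw [hx.apply_of_mem ⟨hc, h0⟩, hx.apply_of_mem ⟨by linarith, le_rfl⟩,
        (hasDensity_deriv hr hp hx₀).sub_eq 0 ⟨by linarith, le_rfl⟩ c ⟨hc, h0⟩]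
      refine intervalIntegral.integral_congr_ae ?_
      filter_upwards [compl_mem_ae_iff.2 (measure_singleton (0 : ℝ))] with u hu0 hu
      rw [uIoc_of_ge h0] at hu
      have : u < 0 := lt_of_le_of_ne hu.2 hu0
      simp [solutionDeriv, this]
  rw [← intervalIntegral.integral_interval_sub_left (a := 0)
    (intervalIntegrable_solutionDeriv hp hf hx₀ (by linarith) hb)
    (intervalIntegrable_solutionDeriv hp hf hx₀ (by linarith) ha), ← key b hb, ← key a ha]
  abel

theorem IsSolution.hasDensity_histSegment (hr : 0 < r) (hp : 1 < p) (hf : RhsLipschitzOnBounded f)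
    (hx₀ : x₀ ∈ sobolevSet n r p) (hx : IsSolution f x₀ x) {t : ℝ} (ht : 0 ≤ t) :
    HasDensity p (histSegment r x t) (fun s => solutionDeriv f x₀ x (t + s)) := by
  refine ⟨?_, fun a ha b hb => ?_⟩
  · have h := (memLp_indicator_solutionDeriv (x := x) hf hx₀ t).comp_measurePreserving
      (measurePreserving_add_left volume t)
    refine (h.restrict (Ioo (-r) 0)).ae_eq ?_
    rw [EventuallyEq, ae_restrict_iff' measurableSet_Ioo]
    refine .of_forall fun s hs => ?_
    have hmem : t + s ∈ Ioo (-r) t := ⟨by linarith [hs.1], by linarith [hs.2]⟩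
    rw [Function.comp_apply, indicator_of_mem hmem]
  · rw [extendZero_apply _ ha, extendZero_apply _ hb, histSegment_apply, histSegment_apply,
      hx.sub_eq_integral hr hp hf hx₀ (by simp; linarith [ha.1]) (by simp; linarith [hb.1])]
    simp

theorem IsSolution.histSegment_mem_sobolevSet (hr : 0 < r) (hp : 1 < p)
    (hf : RhsLipschitzOnBounded f) (hx₀ : x₀ ∈ sobolevSet n r p) (hx : IsSolution f x₀ x) {t : ℝ}
    (ht : 0 ≤ t) : histSegment r x t ∈ sobolevSet n r p :=
  (hx.hasDensity_histSegment hr hp hf hx₀ ht).mem_sobolevSet hr hp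

/-- On the window `[t - r, t]`, the part of the derivative before time `0` is a shift of the initial
derivative, and the part after it is given by `f`. The first part disappears for `t ≥ r`, so `A = 0`
is then allowed and only uniform estimates remain: this is the smoothing effect. -/
theorem IsSolution.sobolevNorm_histSegment_sub_le (hr : 0 < r) (hp : 1 < p)
    (hf : RhsLipschitzOnBounded f) (hx₀ : x₀ ∈ sobolevSet n r p) (hy₀ : y₀ ∈ sobolevSet n r p)
    (hx : IsSolution f x₀ x) (hy : IsSolution f y₀ y) {t A B : ℝ} (ht : 0 ≤ t) (hA0 : 0 ≤ A)
    (hB0 : 0 ≤ B) (hA : t < r → sobolevNorm p (x₀ - y₀) ≤ A)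
    (hB : ∀ u ∈ Icc (t - r) t, 0 ≤ u →
      ‖f (histSegment r x u) - f (histSegment r y u)‖ ≤ B) :
    sobolevNorm p (histSegment r x t - histSegment r y t) ≤
      ‖histSegment r x t - histSegment r y t‖ + A + r ^ (1 / (p : ℝ)) * B := by
  set μ := volume.restrict (Ioo (-r) (0 : ℝ)) with hμ
  have hdx := hx.hasDensity_histSegment hr hp hf hx₀ ht
  have hdy := hy.hasDensity_histSegment hr hp hf hy₀ ht
  have hd := hdx.sub hr hp hdy
  have hd₀ := (hasDensity_deriv hr hp hx₀).sub hr hp (hasDensity_deriv hr hp hy₀)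
  rw [hd.sobolevNorm_eq hr hp, NNReal.coe_add, coe_nnnorm, add_assoc]
  refine add_le_add le_rfl ?_
  -- The contribution of the initial data to the difference of derivatives. What is left after
  -- subtracting it vanishes before time `0` and is bounded by `B` afterwards.
  set e : ℝ → Vec n := indicator (Ioo (-r) 0) (deriv (extendZero x₀) - deriv (extendZero y₀))
    with he
  have hem : AEStronglyMeasurable e volume :=
    ((aestronglyMeasurable_deriv _ _).sub (aestronglyMeasurable_deriv _ _)).indicator
      measurableSet_Ioo
  have hshift := measurePreserving_add_left volume t
  have hem' : AEStronglyMeasurable (fun s => e (t + s)) μ :=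
    (hem.comp_measurePreserving hshift).restrict
  set g : ℝ → Vec n := (fun s => solutionDeriv f x₀ x (t + s)) -
    fun s => solutionDeriv f y₀ y (t + s) with hg
  have h1 : eLpNorm (fun s => e (t + s)) p μ ≤ ENNReal.ofReal A := by
    rcases lt_or_ge t r with htr | htr
    · calc eLpNorm (fun s => e (t + s)) p μ ≤ eLpNorm (e ∘ fun s => t + s) p volume :=
            eLpNorm_mono_measure _ Measure.restrict_le_self
        _ = eLpNorm (deriv (extendZero x₀) - deriv (extendZero y₀)) p μ := by
          rw [eLpNorm_comp_measurePreserving hem hshift, he,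
            eLpNorm_indicator_eq_eLpNorm_restrict measurableSet_Ioo]
        _ ≤ ENNReal.ofReal (sobolevNorm p (x₀ - y₀)) := by
          rw [ENNReal.ofReal_coe_nnreal, hd₀.sobolevNorm_eq hr hp, ENNReal.coe_add,
            ENNReal.coe_toNNReal hd₀.memLp.eLpNorm_lt_top.ne]
          exact le_add_self
        _ ≤ ENNReal.ofReal A := ENNReal.ofReal_le_ofReal (hA htr)
    · have : (fun s => e (t + s)) =ᵐ[μ] 0 := by
        rw [hμ, EventuallyEq, ae_restrict_iff' measurableSet_Ioo]
        refine .of_forall fun s hs => ?_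
        rw [he, indicator_of_notMem (fun h => by linarith [h.2, hs.1])]; rfl
      rw [eLpNorm_congr_ae this]; simp
  have h2 : eLpNorm (g - fun s => e (t + s)) p μ ≤
      ENNReal.ofReal (r ^ (1 / (p : ℝ)) * B) := by
    refine (eLpNorm_le_of_ae_bound (C := B) ?_).trans (le_of_eq ?_)
    · rw [hμ, ae_restrict_iff' measurableSet_Ioo]
      refine .of_forall fun s hs => ?_
      simp only [hg, Pi.sub_apply, solutionDeriv, he]
      split_ifs with h0
      · rw [indicator_of_mem (show t + s ∈ Ioo (-r) 0 from ⟨by linarith [hs.1], h0⟩)]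
        simpa using hB0
      · rw [indicator_of_notMem (fun h => h0 h.2), sub_zero]
        exact hB _ ⟨by linarith [hs.1], by linarith [hs.2]⟩ (not_lt.1 h0)
    · rw [hμ, Measure.restrict_apply_univ, Real.volume_Ioo, ENNReal.ofReal_mul (by positivity),
        zero_sub, neg_neg, ENNReal.ofReal_rpow_of_pos hr, ENNReal.coe_toReal, one_div]
  have h3 : eLpNorm g p μ ≤ ENNReal.ofReal (A + r ^ (1 / (p : ℝ)) * B) := by
    rw [ENNReal.ofReal_add hA0 (by positivity)]
    have hgm : AEStronglyMeasurable g μ := hd.memLp.1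
    have := eLpNorm_add_le (p := p) hem' (hgm.sub hem') (by exact_mod_cast hp.le)
    rw [add_sub_cancel] at this
    exact this.trans (add_le_add h1 h2)
  have := ENNReal.toReal_mono ENNReal.ofReal_ne_top h3
  rwa [ENNReal.toReal_ofReal (by positivity)] at this

/-- Continuity of translations in `L^p` for finite `p`. -/
theorem tendsto_eLpNorm_comp_add_left_sub (hp : 1 < p) {g : ℝ → Vec n} (hg : MemLp g p volume)
    (t : ℝ) :
    Tendsto (fun s => eLpNorm ((fun u => g (s + u)) - fun u => g (t + u)) p volume) (𝓝 t)
      (𝓝 0) := by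
  have : Fact (1 ≤ (p : ℝ≥0∞)) := ⟨by exact_mod_cast hp.le⟩
  have hshift := fun s : ℝ => measurePreserving_add_left volume s
  have hc : Continuous fun s : ℝ => (⟨fun u => s + u, by fun_prop⟩ : C(ℝ, ℝ)) :=
    (ContinuousMap.curry ⟨fun q : ℝ × ℝ => q.1 + q.2, by fun_prop⟩).continuous
  have h := (tendsto_const_nhds (x := hg.toLp g)).compMeasurePreservingLp (hc.tendsto t)
    hshift (hshift t) ENNReal.coe_ne_top
  rw [tendsto_iff_edist_tendsto_0] at h
  refine h.congr fun s => ?_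
  simp only [ContinuousMap.coe_mk, Lp.toLp_compMeasurePreserving hg (hshift _), Lp.edist_toLp_toLp]
  rfl

/-- The segments `x_t` depend continuously on `t` in the Sobolev norm. -/
theorem IsSolution.tendsto_sobolevNorm_sub (hr : 0 < r) (hp : 1 < p)
    (hf : RhsLipschitzOnBounded f) (hx₀ : x₀ ∈ sobolevSet n r p) (hx : IsSolution f x₀ x) {t : ℝ}
    (ht : 0 ≤ t) :
    Tendsto (fun s => sobolevNorm p (histSegment r x s - histSegment r x t)) (𝓝[Ici 0] t)
      (𝓝 0) := by
  -- The cut-off at `t + 1` gives one function in `L^p(ℝ)` whose translates represent the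
  -- derivatives of all segments at times `s < t + 1`.
  set G := indicator (Ioo (-r) (t + 1)) (solutionDeriv f x₀ x) with hG
  have hGm : MemLp G p volume := memLp_indicator_solutionDeriv hf hx₀ _
  have h1 : Tendsto (fun s => ‖histSegment r x s - histSegment r x t‖₊) (𝓝 t) (𝓝 0) := by
    have := (((continuous_histSegment r x).sub continuous_const).nnnorm).tendsto t
      (f := fun s => ‖histSegment r x s - histSegment r x t‖₊)
    simpa using this
  have h2 : Tendsto (fun s => (eLpNorm ((fun u => G (s + u)) - fun u => G (t + u)) p
      volume).toNNReal) (𝓝 t) (𝓝 0) := by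
    have := (ENNReal.tendsto_toNNReal ENNReal.zero_ne_top).comp
      (tendsto_eLpNorm_comp_add_left_sub hp hGm t)
    rwa [ENNReal.toNNReal_zero] at this
  have h3 := h1.add h2
  rw [add_zero] at h3
  refine tendsto_of_tendsto_of_tendsto_of_le_of_le' tendsto_const_nhds
    (h3.mono_left nhdsWithin_le_nhds) (.of_forall fun _ => zero_le) ?_
  filter_upwards [self_mem_nhdsWithin,
    mem_nhdsWithin_of_mem_nhds (Iio_mem_nhds (lt_add_one t))] with s hs0 hs1
  have hd := (hx.hasDensity_histSegment hr hp hf hx₀ hs0).sub hr hp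
    (hx.hasDensity_histSegment hr hp hf hx₀ ht)
  rw [hd.sobolevNorm_eq hr hp]
  have hcomp : ∀ a : ℝ, MemLp (fun u => G (a + u)) p volume := fun a =>
    hGm.comp_measurePreserving (measurePreserving_add_left volume a)
  refine add_le_add le_rfl (ENNReal.toNNReal_mono ((hcomp s).sub (hcomp t)).eLpNorm_lt_top.ne ?_)
  refine le_trans (le_of_eq (eLpNorm_congr_ae ?_)) (eLpNorm_mono_measure _ Measure.restrict_le_self)
  rw [EventuallyEq, ae_restrict_iff' measurableSet_Ioo]
  refine .of_forall fun u hu => ?_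
  have hmem : ∀ a : ℝ, 0 ≤ a → a < t + 1 → a + u ∈ Ioo (-r) (t + 1) := fun a h0 h1 =>
    ⟨by linarith [hu.1], by linarith [hu.2]⟩
  simp only [Pi.sub_apply, hG]
  rw [indicator_of_mem (hmem s hs0 hs1), indicator_of_mem (hmem t ht (by linarith))]

/-! ### Uniformity over bounded sets of initial data -/

theorem IsSolution.sobolevNorm_histSegment_le (hr : 0 < r) (hp : 1 < p)
    (hf : RhsLipschitzOnBounded f) (hf0 : f 0 = 0) (hx₀ : x₀ ∈ sobolevSet n r p)
    (hx : IsSolution f x₀ x) {t A B : ℝ} (ht : 0 ≤ t) (hA0 : 0 ≤ A) (hB0 : 0 ≤ B)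
    (hA : t < r → sobolevNorm p x₀ ≤ A)
    (hB : ∀ u ∈ Icc (t - r) t, 0 ≤ u → ‖f (histSegment r x u)‖ ≤ B) :
    sobolevNorm p (histSegment r x t) ≤ ‖histSegment r x t‖ + A + r ^ (1 / (p : ℝ)) * B := by
  have h0 : ∀ u, histSegment r (0 : C(ℝ, Vec n)) u = 0 := fun _ => rfl
  have := hx.sobolevNorm_histSegment_sub_le hr hp hf hx₀ (zero_mem_sobolevSet hr hp)
    (isSolution_zero hf0) ht hA0 hB0 (by simpa using hA) (by simpa [h0, hf0] using hB)
  simpa [h0] using this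

/-- Every point of the compact `C⁰`-closure starts a global solution, and continuous dependence
extends its bound on `[0, T]` to a uniform neighbourhood. Finitely many neighbourhoods cover the
ball. -/
theorem exists_norm_histSegment_le_of_sobolevBall (hr : 0 < r) (hp : 1 < p)
    (hf : RhsLipschitzOnBounded f) (hfc : ForwardCompleteOn f (sobolevSet n r p)) (R : ℝ≥0)
    (T : ℝ) :
    ∃ M : ℝ, ∀ x₀ ∈ sobolevBall n r p R, ∀ x, IsSolution f x₀ x →
      ∀ t ∈ Icc 0 T, ‖histSegment r x t‖ ≤ M := by
  suffices h : ∃ M : ℝ, ∀ x₀ ∈ closure (sobolevBall n r p R), ∀ x, IsSolution f x₀ x →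
      ∀ t ∈ Icc 0 T, ‖histSegment r x t‖ ≤ M by
    obtain ⟨M, hM⟩ := h
    exact ⟨M, fun x₀ hx₀ => hM x₀ (subset_closure hx₀)⟩
  refine (isCompact_closure_sobolevBall hr hp R).induction_on
    (p := fun S => ∃ M : ℝ, ∀ x₀ ∈ S, ∀ x, IsSolution f x₀ x →
      ∀ t ∈ Icc 0 T, ‖histSegment r x t‖ ≤ M) ⟨0, by simp⟩ ?_ ?_ ?_
  · rintro S S' hS ⟨M, hM⟩
    exact ⟨M, fun x₀ hx₀ => hM x₀ (hS hx₀)⟩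
  · rintro S S' ⟨M, hM⟩ ⟨M', hM'⟩
    refine ⟨max M M', fun x₀ hx₀ x hx t ht => ?_⟩
    rcases hx₀ with h | h
    · exact (hM x₀ h x hx t ht).trans (le_max_left _ _)
    · exact (hM' x₀ h x hx t ht).trans (le_max_right _ _)
  · intro z₀ hz₀
    obtain ⟨z, hz⟩ := hfc z₀ (closure_sobolevBall_subset hr hp R hz₀)
    obtain ⟨M, -, hM⟩ := exists_norm_histSegment_le r z T
    obtain ⟨δ, hδ, hdist⟩ := hz.exists_dist_le hr hf T one_pos
    refine ⟨Metric.ball z₀ δ, mem_nhdsWithin_of_mem_nhds (Metric.ball_mem_nhds z₀ hδ), 1 + M, ?_⟩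
    intro x₀ hx₀ x hx t ht
    have h1 := hdist x₀ x hx (by rwa [← dist_eq_norm]) t ht
    linarith [hM t ht, norm_le_norm_add_norm_sub' (histSegment r x t) (histSegment r z t)]

theorem exists_sobolevNorm_histSegment_sub_le (hr : 0 < r) (hp : 1 < p)
    (hf : RhsLipschitzOnBounded f) (hfc : ForwardCompleteOn f (sobolevSet n r p)) (R : ℝ≥0)
    {T : ℝ} :
    ∃ C : ℝ≥0, ∀ x₀ ∈ sobolevBall n r p R, ∀ y₀ ∈ sobolevBall n r p R,
      ∀ x y, IsSolution f x₀ x → IsSolution f y₀ y → ∀ t ∈ Icc 0 T,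
      sobolevNorm p (histSegment r x t - histSegment r y t) ≤ C * sobolevNorm p (x₀ - y₀) := by
  obtain ⟨M, hM⟩ := exists_norm_histSegment_le_of_sobolevBall hr hp hf hfc R T
  obtain ⟨L, hL, hLip⟩ := hf.exists_const M
  -- The three terms account for the sup norm, the initial derivative and the derivative produced by
  -- `f`.
  refine ⟨(Real.exp (L * T) + 1 + r ^ (1 / (p : ℝ)) * (L * Real.exp (L * T))).toNNReal,
    fun x₀ hx₀ y₀ hy₀ x y hx hy t ht => ?_⟩
  have hgr := hx.norm_histSegment_sub_le_of_bounded hr hy hL hLip (hM x₀ hx₀ x hx) (hM y₀ hy₀ y hy)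
  have hN : ‖x₀ - y₀‖ ≤ sobolevNorm p (x₀ - y₀) := norm_le_sobolevNorm _
  have hgr' : ∀ u ∈ Icc 0 T, ‖histSegment r x u - histSegment r y u‖ ≤
      Real.exp (L * T) * sobolevNorm p (x₀ - y₀) := fun u hu => (hgr u hu).trans (by gcongr)
  have := hx.sobolevNorm_histSegment_sub_le hr hp hf hx₀.1 hy₀.1 hy ht.1
    (A := sobolevNorm p (x₀ - y₀))
    (B := L * (Real.exp (L * T) * sobolevNorm p (x₀ - y₀))) (NNReal.coe_nonneg _) (by positivity)
    (fun _ => le_rfl) (fun u hu hu0 => by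
      have hu' : u ∈ Icc 0 T := ⟨hu0, hu.2.trans ht.2⟩
      exact (hLip _ _ (hM x₀ hx₀ x hx u hu') (hM y₀ hy₀ y hy u hu')).trans
        (by gcongr; exact hgr' u hu'))
  rw [← NNReal.coe_le_coe]
  refine this.trans ?_
  have := hgr' t ht
  rw [NNReal.coe_mul, Real.coe_toNNReal _ (by positivity)]
  linarith

/-- On bounded sets of `W^{1,p}`, attractivity is uniform. -/
theorem exists_time_sobolevNorm_histSegment_le (hr : 0 < r) (hp : 1 < p)
    (hf : RhsLipschitzOnBounded f) (hf0 : f 0 = 0)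
    (hfc : ForwardCompleteOn f (sobolevSet n r p))
    (hstab : ∀ ε : ℝ≥0, 0 < ε → ∃ δ : ℝ≥0, 0 < δ ∧ ∀ x₀ ∈ sobolevBall n r p δ,
      ∀ x, IsSolution f x₀ x → ∀ t, 0 ≤ t → sobolevNorm p (histSegment r x t) ≤ ε)
    (hattr : ∀ x₀ ∈ sobolevSet n r p, ∀ x, IsSolution f x₀ x →
      Tendsto (fun t => sobolevNorm p (histSegment r x t)) atTop (𝓝 0)) (R : ℝ≥0) {ε : ℝ≥0}
    (hε : 0 < ε) :
    ∃ T : ℝ, ∀ x₀ ∈ sobolevBall n r p R, ∀ x, IsSolution f x₀ x →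
      ∀ t, T ≤ t → sobolevNorm p (histSegment r x t) ≤ ε := by
  obtain ⟨δ, hδ, hδε⟩ := hstab ε hε
  obtain ⟨L, hL, hLip⟩ := hf.exists_const 1
  -- If the segments are uniformly at most `η` during a time `r`, the smoothing estimate with `A =
  -- 0` puts the last one in the Sobolev ball of radius `δ`.
  obtain ⟨η, hη, hη1, hηδ⟩ : ∃ η : ℝ, 0 < η ∧ η ≤ 1 ∧
      η + 0 + r ^ (1 / (p : ℝ)) * (L * η) ≤ δ := by
    have hK : 0 < 1 + r ^ (1 / (p : ℝ)) * L := by positivity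
    refine ⟨min 1 (δ / (1 + r ^ (1 / (p : ℝ)) * L)), lt_min one_pos (by positivity),
      min_le_left _ _, ?_⟩
    have := (le_div_iff₀ hK).1 (min_le_right 1 (δ / (1 + r ^ (1 / (p : ℝ)) * L)))
    linarith
  -- Compactness produces `C⁰`-neighbourhoods, which also contain functions outside `X`; hence the
  -- intersection.
  suffices h : ∃ T : ℝ, ∀ x₀ ∈ closure (sobolevBall n r p R) ∩ sobolevSet n r p,
      ∀ x, IsSolution f x₀ x → ∀ t, T ≤ t → sobolevNorm p (histSegment r x t) ≤ ε by
    obtain ⟨T, hT⟩ := h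
    exact ⟨T, fun x₀ hx₀ => hT x₀ ⟨subset_closure hx₀, hx₀.1⟩⟩
  refine (isCompact_closure_sobolevBall hr hp R).induction_on
    (p := fun S => ∃ T : ℝ, ∀ x₀ ∈ S ∩ sobolevSet n r p, ∀ x, IsSolution f x₀ x →
      ∀ t, T ≤ t → sobolevNorm p (histSegment r x t) ≤ ε) ⟨0, by simp⟩ ?_ ?_ ?_
  · rintro S S' hS ⟨T, hT⟩
    exact ⟨T, fun x₀ hx₀ => hT x₀ ⟨hS hx₀.1, hx₀.2⟩⟩
  · rintro S S' ⟨T, hT⟩ ⟨T', hT'⟩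
    refine ⟨max T T', fun x₀ hx₀ x hx t ht => ?_⟩
    rcases hx₀.1 with h | h
    · exact hT x₀ ⟨h, hx₀.2⟩ x hx t ((le_max_left _ _).trans ht)
    · exact hT' x₀ ⟨h, hx₀.2⟩ x hx t ((le_max_right _ _).trans ht)
  · intro z₀ hz₀
    obtain ⟨z, hz⟩ := hfc z₀ (closure_sobolevBall_subset hr hp R hz₀)
    have hlim := hattr z₀ (closure_sobolevBall_subset hr hp R hz₀) z hz
    obtain ⟨T₁, hT₁⟩ := eventually_atTop.1 ((hlim.eventually_lt_const
      (show 0 < Real.toNNReal (η / 2) by simpa using hη)).and (eventually_ge_atTop 0))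
    have hT0 : 0 ≤ T₁ := (hT₁ T₁ le_rfl).2
    have hzT : ∀ t, T₁ ≤ t → ‖histSegment r z t‖ ≤ η / 2 := by
      intro t ht
      refine (norm_le_sobolevNorm (p := p) _).trans ?_
      have := (hT₁ t ht).1.le
      rw [← NNReal.coe_le_coe, Real.coe_toNNReal _ (by positivity)] at this
      exact this
    -- Nearby solutions must be followed for a further time `r` after `z` has become small, so that
    -- smoothing takes effect; from then on stability takes over.
    obtain ⟨δ', hδ', hdist⟩ := hz.exists_dist_le hr hf (T₁ + r) (half_pos hη)
    refine ⟨Metric.ball z₀ δ', mem_nhdsWithin_of_mem_nhds (Metric.ball_mem_nhds z₀ hδ'),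
      T₁ + r, ?_⟩
    rintro x₀ ⟨hx₀, hx₀X⟩ x hx t ht
    have hxT : ∀ u ∈ Icc T₁ (T₁ + r), ‖histSegment r x u‖ ≤ η := by
      intro u hu
      have h1 := hdist x₀ x hx (by rwa [← dist_eq_norm]) u ⟨hT0.trans hu.1, hu.2⟩
      linarith [hzT u hu.1, norm_le_norm_add_norm_sub' (histSegment r x u) (histSegment r z u)]
    have hT2 : 0 ≤ T₁ + r := by linarith
    have hN : sobolevNorm p (histSegment r x (T₁ + r)) ≤ δ := by
      rw [← NNReal.coe_le_coe]
      refine (hx.sobolevNorm_histSegment_le hr hp hf hf0 hx₀X hT2 (A := 0) (B := L * η) le_rfl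
        (by positivity) (fun h => by linarith) (fun u hu hu0 => ?_)).trans (le_trans ?_ hηδ)
      · rw [add_sub_cancel_right] at hu
        have := hLip (histSegment r x u) 0 ((hxT u hu).trans hη1) (by simp)
        rw [hf0, sub_zero, sub_zero] at this
        exact this.trans (by gcongr; exact hxT u hu)
      · gcongr
        exact hxT _ ⟨by linarith, le_rfl⟩
    have := hδε _ ⟨hx.histSegment_mem_sobolevSet hr hp hf hx₀X hT2, hN⟩ _ (hx.timeShift hT2)
      (t - (T₁ + r)) (by linarith)
    rwa [histSegment_timeShift, add_sub_cancel] at this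

/-! ### The flow on `W^{1,p}` -/

/-- `Φ t x₀` is the solution with initial condition `x₀` at time `t`. -/
def IsFlow (f : History n r → Vec n) (Φ : ℝ≥0 → Sobolev n r p → Sobolev n r p) : Prop :=
  ∀ x₀, IsTrajectory f x₀ fun t => Φ t x₀

theorem exists_isFlow (hr : 0 < r) (hp : 1 < p) (hf : RhsLipschitzOnBounded f)
    (hfc : ForwardCompleteOn f (sobolevSet n r p)) :
    ∃ Φ : ℝ≥0 → Sobolev n r p → Sobolev n r p, IsFlow f Φ := by
  choose x hx using fun x₀ : Sobolev n r p => hfc x₀ x₀.2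
  exact ⟨fun t x₀ => ⟨histSegment r (x x₀) t,
    (hx x₀).histSegment_mem_sobolevSet hr hp hf x₀.2 t.2⟩, fun x₀ => ⟨x x₀, hx x₀, fun _ => rfl⟩⟩

variable {Φ : ℝ≥0 → Sobolev n r p → Sobolev n r p}

theorem IsFlow.apply_eq (hΦ : IsFlow f Φ) (hr : 0 < r) (hf : RhsLipschitzOnBounded f)
    {x₀ : Sobolev n r p} (hx : IsSolution f x₀ x) (t : ℝ≥0) :
    (Φ t x₀ : History n r) = histSegment r x t := by
  obtain ⟨y, hy, hyΦ⟩ := hΦ x₀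
  rw [hyΦ t]
  exact hy.histSegment_eq hr hf hx t.2

/-- By uniqueness of solutions, the existentially quantified trajectories in the stability notions
can all be replaced by `Φ`. -/
theorem IsFlow.trajectory_eq (hΦ : IsFlow f Φ) (hr : 0 < r) (hf : RhsLipschitzOnBounded f)
    {x₀ : Sobolev n r p} {φ : ℝ≥0 → Sobolev n r p} (hφ : IsTrajectory f x₀ φ) (t : ℝ≥0) :
    φ t = Φ t x₀ := by
  obtain ⟨x, hx, hxφ⟩ := hφ
  exact Subtype.ext ((hxφ t).trans (hΦ.apply_eq hr hf hx t).symm)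

theorem IsFlow.zero_apply (hΦ : IsFlow f Φ) (x₀ : Sobolev n r p) : Φ 0 x₀ = x₀ := by
  obtain ⟨x, hx, hxΦ⟩ := hΦ x₀
  exact Subtype.ext ((hxΦ 0).trans hx.initial)

theorem IsFlow.add_apply (hΦ : IsFlow f Φ) (hr : 0 < r) (hf : RhsLipschitzOnBounded f)
    (s t : ℝ≥0) (x₀ : Sobolev n r p) : Φ (s + t) x₀ = Φ s (Φ t x₀) := by
  obtain ⟨x, hx, hxΦ⟩ := hΦ x₀
  have h : IsSolution f (Φ t x₀ : History n r) (timeShift t x) := by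
    rw [hxΦ t]; exact hx.timeShift t.2
  apply Subtype.ext
  rw [hΦ.apply_eq hr hf h, histSegment_timeShift, hxΦ, NNReal.coe_add, add_comm]

theorem IsFlow.exists_lipschitz (hΦ : IsFlow f Φ) (hr : 0 < r) (hp : 1 < p)
    (hf : RhsLipschitzOnBounded f) (hfc : ForwardCompleteOn f (sobolevSet n r p)) (R T : ℝ≥0) :
    ∃ C : ℝ≥0, ∀ t ≤ T, ∀ x y : Sobolev n r p, sobolevNorm p x.1 ≤ R → sobolevNorm p y.1 ≤ R →
      sobolevNorm p ((Φ t x).1 - (Φ t y).1) ≤ C * sobolevNorm p (x.1 - y.1) := by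
  obtain ⟨C, hC⟩ := exists_sobolevNorm_histSegment_sub_le hr hp hf hfc R (T := T)
  refine ⟨C, fun t ht x₀ y₀ hx₀ hy₀ => ?_⟩
  obtain ⟨x, hx, hxΦ⟩ := hΦ x₀
  obtain ⟨y, hy, hyΦ⟩ := hΦ y₀
  rw [hxΦ, hyΦ]
  exact hC _ ⟨x₀.2, hx₀⟩ _ ⟨y₀.2, hy₀⟩ x y hx hy t ⟨t.2, by exact_mod_cast ht⟩

theorem IsFlow.apply_zero (hΦ : IsFlow f Φ) (hr : 0 < r) (hp : 1 < p)
    (hf : RhsLipschitzOnBounded f) (hf0 : f 0 = 0) (t : ℝ≥0) :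
    Φ t ⟨0, zero_mem_sobolevSet hr hp⟩ = ⟨0, zero_mem_sobolevSet hr hp⟩ :=
  Subtype.ext (hΦ.apply_eq hr hf (x := 0) (isSolution_zero hf0) t)

/-- Uniform attractivity of the flow on bounded sets. -/
def UniformlyAttractive (Φ : ℝ≥0 → Sobolev n r p → Sobolev n r p) : Prop :=
  ∀ R ε : ℝ≥0, 0 < ε → ∃ T : ℝ≥0, ∀ t, T ≤ t → ∀ x : Sobolev n r p,
    sobolevNorm p x.1 ≤ R → sobolevNorm p (Φ t x).1 ≤ ε

theorem IsFlow.uniformlyAttractive_of_gas (hΦ : IsFlow f Φ) (hr : 0 < r) (hp : 1 < p)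
    (hf : RhsLipschitzOnBounded f) (hf0 : f 0 = 0)
    (hfc : ForwardCompleteOn f (sobolevSet n r p)) (h : GAS p f) : UniformlyAttractive Φ := by
  intro R ε hε
  refine (exists_time_sobolevNorm_histSegment_le hr hp hf hf0 hfc ?_ ?_ R hε).elim fun T hT => ?_
  · intro ε hε
    obtain ⟨δ, hδ, H⟩ := h.1 ε hε
    refine ⟨δ, hδ, fun x₀ hx₀ x hx t ht => ?_⟩
    obtain ⟨φ, ⟨y, hy, hyφ⟩, hφ⟩ := H ⟨x₀, hx₀.1⟩ hx₀.2
    lift t to ℝ≥0 using ht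
    rw [hx.histSegment_eq hr hf (y := y) hy t.coe_nonneg, ← hyφ]
    exact hφ t
  · intro x₀ hx₀ x hx
    obtain ⟨φ, ⟨y, hy, hyφ⟩, hφ⟩ := h.2 ⟨x₀, hx₀⟩
    refine (hφ.comp Real.tendsto_toNNReal_atTop).congr' ?_
    filter_upwards [eventually_ge_atTop 0] with t ht
    rw [Function.comp_apply, hyφ, Real.coe_toNNReal _ ht, hx.histSegment_eq hr hf (y := y) hy ht]
  · refine ⟨T.toNNReal, fun t ht x₀ hx₀ => ?_⟩
    obtain ⟨x, hx, hxΦ⟩ := hΦ x₀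
    rw [hxΦ]
    exact hT _ ⟨x₀.2, hx₀⟩ x hx t (Real.toNNReal_le_iff_le_coe.1 ht)

/-! ### Comparison functions -/

/-- The average of `ψ` over `[s, 2s]`, a continuous majorant of a monotone function `ψ`. -/
noncomputable def average (ψ : ℝ≥0 → ℝ≥0) (s : ℝ≥0) : ℝ≥0 :=
  (∫ v in (1 : ℝ)..2, (ψ (s * v.toNNReal) : ℝ)).toNNReal

section Average

variable {ψ χ : ℝ≥0 → ℝ≥0}

theorem intervalIntegrable_comp_mul (hψ : Monotone ψ) (s : ℝ≥0) (a b : ℝ) :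
    IntervalIntegrable (fun v : ℝ => (ψ (s * v.toNNReal) : ℝ)) volume a b := by
  refine Monotone.intervalIntegrable fun u v huv => ?_
  have := hψ (mul_le_mul_right (Real.toNNReal_le_toNNReal huv) s)
  exact_mod_cast this

theorem average_mono (hψ : Monotone ψ) (hχ : Monotone χ) {s t : ℝ≥0}
    (h : ∀ v, ψ (s * v) ≤ χ (t * v)) : average ψ s ≤ average χ t := by
  refine Real.toNNReal_le_toNNReal (intervalIntegral.integral_mono_on one_le_two
    (intervalIntegrable_comp_mul hψ s 1 2) (intervalIntegrable_comp_mul hχ t 1 2) fun v _ => ?_)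
  exact_mod_cast h _

theorem monotone_average (hψ : Monotone ψ) : Monotone (average ψ) := fun _ _ hst =>
  average_mono hψ hψ fun v => hψ (mul_le_mul_left hst v)

theorem le_average (hψ : Monotone ψ) (s : ℝ≥0) : ψ s ≤ average ψ s := by
  refine NNReal.le_toNNReal_of_coe_le ?_
  have := intervalIntegral.integral_mono_on one_le_two
    (intervalIntegrable_const (c := (ψ s : ℝ)) (μ := volume)) (intervalIntegrable_comp_mul hψ s 1 2)
    fun v hv => by
      refine NNReal.coe_le_coe.2 (hψ ?_)
      exact le_mul_of_one_le_right zero_le (by simpa using hv.1)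
  norm_num at this
  exact this

theorem average_le (hψ : Monotone ψ) (s : ℝ≥0) : average ψ s ≤ ψ (s * 2) := by
  refine Real.toNNReal_le_iff_le_coe.2 ?_
  have := intervalIntegral.integral_mono_on one_le_two (intervalIntegrable_comp_mul hψ s 1 2)
    (intervalIntegrable_const (c := (ψ (s * 2) : ℝ)) (μ := volume)) fun v hv => by
      refine NNReal.coe_le_coe.2 (hψ ?_)
      gcongr
      simpa using hv.2
  norm_num at this
  exact this

theorem average_eq_of_pos {s : ℝ≥0} (hψ : Monotone ψ) (hs : 0 < s) :
    average ψ s = ((s : ℝ)⁻¹ * ((∫ u in (0 : ℝ)..s * 2, (ψ u.toNNReal : ℝ)) -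
      ∫ u in (0 : ℝ)..s, (ψ u.toNNReal : ℝ))).toNNReal := by
  have hint : ∀ a b, IntervalIntegrable (fun v : ℝ => (ψ v.toNNReal : ℝ)) volume a b := by
    simpa using intervalIntegrable_comp_mul hψ 1
  rw [average, intervalIntegral.integral_interval_sub_left (hint _ _) (hint _ _)]
  have h := intervalIntegral.smul_integral_comp_mul_left (fun u : ℝ => (ψ u.toNNReal : ℝ)) (s : ℝ)
    (a := 1) (b := 2)
  rw [mul_one] at h
  rw [← h, smul_eq_mul, inv_mul_cancel_left₀ (by exact_mod_cast hs.ne')]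
  simp only [Real.toNNReal_mul s.coe_nonneg, Real.toNNReal_coe]

/-- Away from zero, the substitution `u = s v` expresses the average by primitives. At zero it is
squeezed between `0` and `ψ (2 s)`. -/
theorem continuous_average (hψ : Monotone ψ) (h0 : Tendsto ψ (𝓝 0) (𝓝 0)) :
    Continuous (average ψ) := by
  have hψ0 : ψ 0 = 0 := tendsto_nhds_unique (tendsto_pure_nhds ψ 0 |>.mono_right le_rfl)
    (h0.mono_left (pure_le_nhds 0))
  have hint : ∀ a b, IntervalIntegrable (fun v : ℝ => (ψ v.toNNReal : ℝ)) volume a b := by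
    simpa using intervalIntegrable_comp_mul hψ 1
  rw [continuous_iff_continuousAt]
  intro s
  rcases eq_or_ne s 0 with rfl | hs
  · have h2 : Tendsto (fun s : ℝ≥0 => ψ (s * 2)) (𝓝 0) (𝓝 0) :=
      h0.comp (by simpa using (continuous_mul_const (2 : ℝ≥0)).tendsto 0)
    have : average ψ 0 = 0 := by simpa [hψ0] using average_le hψ 0
    rw [ContinuousAt, this]
    exact tendsto_of_tendsto_of_tendsto_of_le_of_le tendsto_const_nhds h2 (fun _ => zero_le)
      (average_le hψ)
  · have hs' : 0 < s := pos_iff_ne_zero.2 hs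
    have hF := intervalIntegral.continuous_primitive hint 0
    have hc : ContinuousAt (fun s : ℝ≥0 => ((s : ℝ)⁻¹ *
        ((∫ u in (0 : ℝ)..s * 2, (ψ u.toNNReal : ℝ)) -
          ∫ u in (0 : ℝ)..s, (ψ u.toNNReal : ℝ))).toNNReal) s := by
      refine continuous_real_toNNReal.continuousAt.comp (ContinuousAt.mul ?_ ?_)
      · exact NNReal.continuous_coe.continuousAt.inv₀ (by exact_mod_cast hs)
      · exact ((hF.comp (NNReal.continuous_coe.mul continuous_const)).sub
          (hF.comp NNReal.continuous_coe)).continuousAt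
    refine hc.congr ?_
    filter_upwards [Ioi_mem_nhds hs'] with u hu
    exact (average_eq_of_pos hψ hu).symm

end Average

/-- Turns a Lipschitz bound on balls into an upper bound of class `K_∞`. Averaging gives continuity;
the added `s` gives strict monotonicity and unboundedness. -/
theorem exists_classKInf_mul_le {L : ℝ≥0 → ℝ≥0} (hL : Monotone L) :
    ∃ ρ, ClassKInf ρ ∧ ∀ s, L s * s ≤ ρ s := by
  have hψ : Monotone fun s => L s * s := hL.mul' monotone_id
  have h0 : Tendsto (fun s => L s * s) (𝓝 0) (𝓝 0) := by
    have h1 : Tendsto (fun s => L 1 * s) (𝓝 0) (𝓝 0) := by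
      simpa using (continuous_const_mul (L 1)).tendsto 0
    refine tendsto_of_tendsto_of_tendsto_of_le_of_le' tendsto_const_nhds h1
      (.of_forall fun _ => zero_le) ?_
    filter_upwards [Iio_mem_nhds (zero_lt_one (α := ℝ≥0))] with s hs
    exact mul_le_mul_left (hL hs.le) s
  refine ⟨fun s => average (fun s => L s * s) s + s, ⟨⟨?_, ?_, ?_⟩, ?_⟩, fun s => ?_⟩
  · exact (continuous_average hψ h0).add continuous_id
  · exact (monotone_average hψ).add_strictMono strictMono_id
  · simpa using average_le hψ 0
  · exact tendsto_atTop_mono (fun s => le_add_self) tendsto_id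
  · exact (le_average hψ s).trans le_self_add

/-- Averaging in `s` gives continuity, and the term `s / (1 + t)` makes the majorant strictly
increasing in `s` without spoiling the decay in `t`. -/
theorem exists_classKL_ge {ψ : ℝ≥0 → ℝ≥0 → ℝ≥0} (hmono : ∀ t, Monotone fun s => ψ s t)
    (hanti : ∀ s, Antitone (ψ s)) (hlim : ∀ s, Tendsto (ψ s) atTop (𝓝 0))
    (h0 : Tendsto (fun s => ψ s 0) (𝓝 0) (𝓝 0)) :
    ∃ σ, ClassKL σ ∧ ∀ s t, ψ s t ≤ σ s t := by
  have h0' : ∀ t, Tendsto (fun s => ψ s t) (𝓝 0) (𝓝 0) := fun t =>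
    tendsto_of_tendsto_of_tendsto_of_le_of_le tendsto_const_nhds h0 (fun _ => zero_le)
      fun s => hanti s zero_le
  refine ⟨fun s t => average (fun s => ψ s t) s + s * (1 + t)⁻¹, ⟨fun t => ⟨?_, ?_, ?_⟩,
    fun s t t' htt => ?_, fun s => ?_⟩, fun s t => ?_⟩
  · exact (continuous_average (hmono t) (h0' t)).add (continuous_mul_const _)
  · exact (monotone_average (hmono t)).add_strictMono fun a b hab => by
      have : 0 < (1 + t)⁻¹ := by positivity
      exact mul_lt_mul_of_pos_right hab this
  · have h1 : ψ 0 t = 0 := tendsto_nhds_unique (tendsto_pure_nhds (fun s => ψ s t) 0)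
      ((h0' t).mono_left (pure_le_nhds 0))
    simpa [h1] using average_le (hmono t) 0
  · refine add_le_add (average_mono (hmono t') (hmono t) fun v => hanti _ htt) ?_
    gcongr
  · have h1 : Tendsto (fun t : ℝ≥0 => s * (1 + t)⁻¹) atTop (𝓝 0) := by
      rw [← NNReal.tendsto_coe]
      have := (tendsto_const_nhds (x := (s : ℝ))).div_atTop
        (tendsto_atTop_add_const_left atTop (1 : ℝ) (NNReal.tendsto_coe_atTop.2 tendsto_id))
      simpa [div_eq_mul_inv] using this
    have h2 : Tendsto (fun t => average (fun s => ψ s t) s) atTop (𝓝 0) :=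
      tendsto_of_tendsto_of_tendsto_of_le_of_le tendsto_const_nhds (hlim (s * 2))
        (fun _ => zero_le) fun t => average_le (hmono t) s
    simpa using h2.add h1
  · exact (le_average (hmono t) s).trans le_self_add

/-! ### A converse Lyapunov theorem for abstract flows -/

/-- The real exponential as a function `ℝ≥0 → ℝ≥0`. -/
noncomputable def expNN (t : ℝ≥0) : ℝ≥0 := (Real.exp t).toNNReal

theorem coe_expNN (t : ℝ≥0) : (expNN t : ℝ) = Real.exp t := Real.coe_toNNReal _ (Real.exp_pos _).le

theorem expNN_add (s t : ℝ≥0) : expNN (s + t) = expNN s * expNN t := by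
  rw [← NNReal.coe_inj, NNReal.coe_mul, coe_expNN, coe_expNN, coe_expNN, NNReal.coe_add,
    Real.exp_add]

theorem monotone_expNN : Monotone expNN := fun s t hst => by
  rw [← NNReal.coe_le_coe, coe_expNN, coe_expNN, Real.exp_le_exp]
  exact_mod_cast hst

theorem expNN_zero : expNN 0 = 1 := by
  rw [← NNReal.coe_inj, coe_expNN]; simp

/-- A semiflow on a set with a "norm" `N` and a "distance" `D`, with equilibrium `z`, that is
Lipschitz on bounded sets and uniformly attracts bounded sets to `z`. -/
structure IsAttractiveSemiflow {X : Type*} (N : X → ℝ≥0) (D : X → X → ℝ≥0) (z : X)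
    (Φ : ℝ≥0 → X → X) : Prop where
  zero_apply : ∀ x, Φ 0 x = x
  add_apply : ∀ s t x, Φ (s + t) x = Φ s (Φ t x)
  apply_zero : ∀ t, Φ t z = z
  norm_zero : N z = 0
  dist_zero : ∀ x, D x z = N x
  dist_comm : ∀ x y, D x y = D y x
  norm_le_add : ∀ x y, N x ≤ N y + D x y
  lipschitz : ∀ R T : ℝ≥0, ∃ C : ℝ≥0, ∀ t ≤ T, ∀ x y, N x ≤ R → N y ≤ R →
    D (Φ t x) (Φ t y) ≤ C * D x y
  attractive : ∀ R ε : ℝ≥0, 0 < ε → ∃ T : ℝ≥0, ∀ t, T ≤ t → ∀ x, N x ≤ R → N (Φ t x) ≤ ε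

/-- The largest exponentially weighted excess of the norm over the level `c` along the orbit. -/
noncomputable def weightedExcess {X : Type*} (N : X → ℝ≥0) (Φ : ℝ≥0 → X → X) (c : ℝ≥0) (x : X) :
    ℝ≥0 :=
  ⨆ t, (N (Φ t x) - c) * expNN t

namespace IsAttractiveSemiflow

variable {X : Type*} {N : X → ℝ≥0} {D : X → X → ℝ≥0} {z : X} {Φ : ℝ≥0 → X → X} {c : ℝ≥0}

/-- Late times are covered by uniform attraction, early times by comparison with the equilibrium. -/
theorem exists_bound (h : IsAttractiveSemiflow N D z Φ) (R : ℝ≥0) :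
    ∃ M, ∀ t x, N x ≤ R → N (Φ t x) ≤ M := by
  obtain ⟨T, hT⟩ := h.attractive R 1 one_pos
  obtain ⟨C, hC⟩ := h.lipschitz R T
  refine ⟨max 1 (C * R), fun t x hx => ?_⟩
  rcases le_total T t with ht | ht
  · exact (hT t ht x hx).trans (le_max_left _ _)
  · have := hC t ht x z hx (by simp [h.norm_zero])
    rw [h.apply_zero, h.dist_zero, h.dist_zero] at this
    exact (this.trans (by gcongr)).trans (le_max_right _ _)

theorem bddAbove (h : IsAttractiveSemiflow N D z Φ) (hc : 0 < c) (x : X) :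
    BddAbove (range fun t => (N (Φ t x) - c) * expNN t) := by
  obtain ⟨T, hT⟩ := h.attractive (N x) c hc
  obtain ⟨M, hM⟩ := h.exists_bound (N x)
  refine ⟨M * expNN T, ?_⟩
  rintro _ ⟨t, rfl⟩
  rcases le_total T t with ht | ht
  · simp [tsub_eq_zero_of_le (hT t ht x le_rfl)]
  · exact mul_le_mul' (tsub_le_self.trans (hM t x le_rfl)) (monotone_expNN ht)

/-- Since `c > 0`, one time `T` serves the whole ball: later the excess vanishes, earlier the weight
is at most `e^T` and the flow is Lipschitz. -/
theorem weightedExcess_lipschitz (h : IsAttractiveSemiflow N D z Φ) (hc : 0 < c) (R : ℝ≥0) :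
    ∃ C, ∀ x y, N x ≤ R → N y ≤ R →
      weightedExcess N Φ c x ≤ weightedExcess N Φ c y + C * D x y := by
  obtain ⟨T, hT⟩ := h.attractive R c hc
  obtain ⟨C, hC⟩ := h.lipschitz R T
  refine ⟨C * expNN T, fun x y hx hy => ciSup_le fun t => ?_⟩
  rcases le_total T t with ht | ht
  · simp [tsub_eq_zero_of_le (hT t ht x hx)]
  · have h1 : N (Φ t x) - c ≤ (N (Φ t y) - c) + C * D x y := by
      rw [tsub_le_iff_right]
      calc N (Φ t x) ≤ N (Φ t y) + D (Φ t x) (Φ t y) := h.norm_le_add _ _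
        _ ≤ ((N (Φ t y) - c) + c) + C * D x y := add_le_add le_tsub_add (hC t ht x y hx hy)
        _ = _ := by ring
    calc (N (Φ t x) - c) * expNN t ≤ ((N (Φ t y) - c) + C * D x y) * expNN t := by gcongr
      _ = (N (Φ t y) - c) * expNN t + C * D x y * expNN t := add_mul _ _ _
      _ ≤ weightedExcess N Φ c y + C * D x y * expNN T :=
        add_le_add (le_ciSup (h.bddAbove hc y) t) (by gcongr; exact monotone_expNN ht)
      _ = _ := by ring

theorem weightedExcess_zero (h : IsAttractiveSemiflow N D z Φ) : weightedExcess N Φ c z = 0 := by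
  simp [weightedExcess, h.apply_zero, h.norm_zero]

theorem le_weightedExcess (h : IsAttractiveSemiflow N D z Φ) (hc : 0 < c) (x : X) :
    N x - c ≤ weightedExcess N Φ c x := by
  have : (N (Φ 0 x) - c) * expNN 0 ≤ weightedExcess N Φ c x := le_ciSup (h.bddAbove hc x) 0
  rwa [h.zero_apply, expNN_zero, mul_one] at this

/-- Multiplying by `e^s` turns the supremum along the shifted orbit into one over the times `t + s`
only. -/
theorem weightedExcess_apply_mul_le (h : IsAttractiveSemiflow N D z Φ) (hc : 0 < c) (s : ℝ≥0)
    (x : X) : weightedExcess N Φ c (Φ s x) * expNN s ≤ weightedExcess N Φ c x := by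
  rw [weightedExcess, NNReal.iSup_mul]
  refine ciSup_le fun t => ?_
  rw [← h.add_apply, mul_assoc, ← expNN_add]
  exact le_ciSup (h.bddAbove hc x) (t + s)

end IsAttractiveSemiflow

theorem classKInf_tsum_tsub {w : ℕ → ℝ≥0} (hw : ∀ q, 0 < w q) (hsum : Summable w) :
    ClassKInf fun s => ∑' q : ℕ, w q * (s - 1 / ((q : ℝ≥0) + 1)) := by
  have hs : ∀ s : ℝ≥0, Summable fun q : ℕ => w q * (s - 1 / ((q : ℝ≥0) + 1)) := fun s =>
    NNReal.summable_of_le (fun q => mul_le_mul_right tsub_le_self _) (hsum.mul_right s)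
  refine ⟨⟨?_, fun s t hst => ?_, by simp⟩, ?_⟩
  · have hlip : LipschitzWith (∑' q, w q)
        fun s : ℝ≥0 => ((∑' q : ℕ, w q * (s - 1 / ((q : ℝ≥0) + 1)) : ℝ≥0) : ℝ) := by
      refine LipschitzWith.of_le_add_mul _ fun s t => ?_
      have key : ∑' q : ℕ, w q * (s - 1 / ((q : ℝ≥0) + 1)) ≤
          ∑' q : ℕ, w q * (t - 1 / ((q : ℝ≥0) + 1)) + (∑' q, w q) * nndist s t := by
        rw [← NNReal.tsum_mul_right, ← (hs t).tsum_add (hsum.mul_right _)]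
        refine (hs s).tsum_le_tsum (fun q => ?_) ((hs t).add (hsum.mul_right _))
        rw [← mul_add]
        refine mul_le_mul_right ?_ _
        have h1 : s ≤ t + nndist s t := by
          rw [← NNReal.coe_le_coe, NNReal.coe_add, coe_nndist, NNReal.dist_eq]
          linarith [le_abs_self ((s : ℝ) - t)]
        rw [tsub_le_iff_right]
        refine h1.trans ?_
        rw [add_right_comm]
        gcongr
        exact le_tsub_add
      exact_mod_cast key
    exact NNReal.isEmbedding_coe.continuous_iff.2 hlip.continuous
  -- A term whose truncation level lies below `t` increases strictly from `s` to `t`, even if it is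
  -- still zero at `s`.
  · obtain ⟨q, hq⟩ : ∃ q : ℕ, 1 / ((q : ℝ≥0) + 1) < t := by
      obtain ⟨q, hq⟩ := exists_nat_one_div_lt (NNReal.coe_pos.2 (zero_le.trans_lt hst))
      exact ⟨q, by exact_mod_cast hq⟩
    refine NNReal.tsum_lt_tsum (i := q) (fun q => ?_) ?_ (hs t)
    · exact mul_le_mul_right (tsub_le_tsub_right hst.le _) _
    · refine mul_lt_mul_of_pos_left ?_ (hw q)
      rw [lt_tsub_iff_right]
      rcases le_total s (1 / ((q : ℝ≥0) + 1)) with h | h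
      · rwa [tsub_eq_zero_of_le h, zero_add]
      · rwa [tsub_add_cancel_of_le h]
  · refine tendsto_atTop_mono (f := fun s : ℝ≥0 => w 0 * (s - 1)) (fun s => ?_) ?_
    · have := (hs s).le_tsum 0 (fun _ _ => zero_le)
      simpa using this
    · refine tendsto_atTop.2 fun b => ?_
      filter_upwards [eventually_ge_atTop (b / w 0 + 1)] with s hs
      rw [← div_le_iff₀' (hw 0)]
      exact le_tsub_of_add_le_right hs

namespace IsAttractiveSemiflow

variable {X : Type*} {N : X → ℝ≥0} {D : X → X → ℝ≥0} {z : X} {Φ : ℝ≥0 → X → X}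

theorem exists_lyapunov (h : IsAttractiveSemiflow N D z Φ) :
    ∃ (V : X → ℝ≥0) (a L : ℝ≥0 → ℝ≥0), ClassKInf a ∧ Monotone L ∧ V z = 0 ∧
      (∀ R x y, N x ≤ R → N y ≤ R → V x ≤ V y + L R * D x y) ∧
      (∀ x, a (N x) ≤ V x) ∧ ∀ t x, V (Φ t x) * expNN t ≤ V x := by
  have hc : ∀ q : ℕ, (0 : ℝ≥0) < 1 / ((q : ℝ≥0) + 1) := fun q => by positivity
  choose K hK using fun q m : ℕ => h.weightedExcess_lipschitz (hc q) (m : ℝ≥0)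
  set U : ℕ → X → ℝ≥0 := fun q => weightedExcess N Φ (1 / ((q : ℝ≥0) + 1)) with hU
  -- A diagonal choice: `w q` tames the Lipschitz constants on the balls of radius `m ≤ q`. For a
  -- fixed `m` only finitely many `q` are left out, so the series of Lipschitz constants converges
  -- on every ball.
  set w : ℕ → ℝ≥0 := fun q => (1 / 2) ^ q / (1 + ∑ m ∈ Finset.range (q + 1), K q m) with hw
  have hw0 : ∀ q, 0 < w q := fun q => by positivity
  have hgeom : Summable fun q : ℕ => (1 / 2 : ℝ≥0) ^ q := NNReal.summable_geometric (by
    rw [← NNReal.coe_lt_coe]; norm_num)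
  have hw1 : ∀ q, w q ≤ (1 / 2) ^ q := fun q => div_le_self zero_le le_self_add
  have hwK : ∀ q m, m ≤ q → w q * K q m ≤ (1 / 2) ^ q := by
    intro q m hm
    rw [hw, div_mul_eq_mul_div]
    refine div_le_of_le_mul₀ (by positivity) (by positivity) (mul_le_mul_right ?_ _)
    exact (Finset.single_le_sum (f := fun m => K q m) (fun _ _ => zero_le)
      (Finset.mem_range.2 (Nat.lt_succ_of_le hm))).trans le_add_self
  have hsumK : ∀ m, Summable fun q => w q * K q m := by
    intro m
    rw [← NNReal.summable_nat_add_iff m]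
    exact NNReal.summable_of_le (fun q => hwK (q + m) m (Nat.le_add_left m q))
      ((NNReal.summable_nat_add_iff m).2 hgeom)
  have hlip : ∀ (q m : ℕ) (x y : X), N x ≤ m → N y ≤ m → U q x ≤ U q y + K q m * D x y := fun q m => hK q m
  have hsumU : ∀ x, Summable fun q => w q * U q x := by
    intro x
    obtain ⟨m, hm⟩ := exists_nat_ge (N x)
    refine NNReal.summable_of_le (fun q => ?_) ((hsumK m).mul_right (N x))
    rw [mul_assoc]
    have := hlip q m x z hm (by simp [h.norm_zero])
    rw [show U q z = 0 from h.weightedExcess_zero, zero_add, h.dist_zero] at this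
    exact mul_le_mul_right this _
  refine ⟨fun x => ∑' q, w q * U q x, _,
    -- The term `m = ⌈R⌉₊` alone would suffice as a constant; summing up to it makes the bound
    -- monotone in `R`.
    fun R => ∑ m ∈ Finset.range (⌈R⌉₊ + 1), ∑' q, w q * K q m,
    classKInf_tsum_tsub hw0 (NNReal.summable_of_le hw1 hgeom), ?_, ?_, ?_, ?_, ?_⟩
  · intro R R' hR
    exact Finset.sum_le_sum_of_subset (Finset.range_mono (by gcongr))
  · simp [hU, h.weightedExcess_zero]
  · intro R x y hx hy
    have hR := Nat.le_ceil R
    calc ∑' q, w q * U q x ≤ ∑' q, (w q * U q y + w q * K q ⌈R⌉₊ * D x y) := by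
          refine (hsumU x).tsum_le_tsum (fun q => ?_) ((hsumU y).add ((hsumK _).mul_right _))
          rw [mul_assoc, ← mul_add]
          exact mul_le_mul_right (hlip q _ x y (hx.trans hR) (hy.trans hR)) _
      _ = ∑' q, w q * U q y + (∑' q, w q * K q ⌈R⌉₊) * D x y := by
        rw [(hsumU y).tsum_add ((hsumK _).mul_right _), NNReal.tsum_mul_right]
      _ ≤ _ := by
        gcongr
        exact Finset.single_le_sum (f := fun m => ∑' q, w q * K q m) (fun _ _ => zero_le)
          (Finset.mem_range.2 (Nat.lt_succ_self _))
  · intro x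
    refine Summable.tsum_le_tsum (fun q => ?_) ?_ (hsumU x)
    · exact mul_le_mul_right (h.le_weightedExcess (hc q) x) _
    · exact NNReal.summable_of_le
        (fun q => mul_le_mul_right (h.le_weightedExcess (hc q) x) _) (hsumU x)
  · intro t x
    rw [← NNReal.tsum_mul_right]
    refine Summable.tsum_le_tsum (fun q => ?_) ((hsumU _).mul_right _) (hsumU x)
    rw [mul_assoc]
    exact mul_le_mul_right (h.weightedExcess_apply_mul_le (hc q) t x) _

/-- Orbits of an attractive and stable semiflow have a bound of class `KL`. -/
theorem exists_classKL (h : IsAttractiveSemiflow N D z Φ)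
    (hstab : ∀ ε : ℝ≥0, 0 < ε → ∃ δ : ℝ≥0, 0 < δ ∧ ∀ x, N x ≤ δ → ∀ t, N (Φ t x) ≤ ε) :
    ∃ σ, ClassKL σ ∧ ∀ x t, N (Φ t x) ≤ σ (N x) t := by
  -- Taking all times `τ ≥ t` and all states in the ball makes the supremum monotone in both
  -- arguments by construction.
  set S : ℝ≥0 → ℝ≥0 → Set ℝ≥0 := fun s t => {v | ∃ τ x, t ≤ τ ∧ N x ≤ s ∧ N (Φ τ x) = v} with hS
  have hbdd : ∀ s t, BddAbove (S s t) := by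
    intro s t
    obtain ⟨M, hM⟩ := h.exists_bound s
    refine ⟨M, ?_⟩
    rintro _ ⟨τ, x, -, hx, rfl⟩
    exact hM τ x hx
  have hlim : ∀ {α : Type} {l : Filter α} {g : α → ℝ≥0},
      (∀ ε : ℝ≥0, 0 < ε → ∀ᶠ a in l, g a ≤ ε) → Tendsto g l (𝓝 0) := by
    intro α l g hg
    refine tendsto_order.2 ⟨fun a ha => absurd ha not_lt_zero, fun a ha => ?_⟩
    obtain ⟨b, hb, hba⟩ := exists_between ha
    exact (hg b hb).mono fun _ h => h.trans_lt hba
  refine (exists_classKL_ge (ψ := fun s t => sSup (S s t)) ?_ ?_ ?_ ?_).imp fun σ hσ =>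
    ⟨hσ.1, fun x t => (le_csSup (hbdd _ _) ⟨t, x, le_rfl, le_rfl, rfl⟩).trans (hσ.2 _ _)⟩
  · intro t s s' hs
    refine csSup_le_csSup' (hbdd _ _) ?_
    rintro _ ⟨τ, x, hτ, hx, rfl⟩
    exact ⟨τ, x, hτ, hx.trans hs, rfl⟩
  · intro s t t' ht
    refine csSup_le_csSup' (hbdd _ _) ?_
    rintro _ ⟨τ, x, hτ, hx, rfl⟩
    exact ⟨τ, x, ht.trans hτ, hx, rfl⟩
  · intro s
    refine hlim fun ε hε => ?_
    obtain ⟨T, hT⟩ := h.attractive s ε hε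
    filter_upwards [eventually_ge_atTop T] with t ht
    refine csSup_le' ?_
    rintro _ ⟨τ, x, hτ, hx, rfl⟩
    exact hT τ (ht.trans hτ) x hx
  · refine hlim fun ε hε => ?_
    obtain ⟨δ, hδ, H⟩ := hstab ε hε
    filter_upwards [Iio_mem_nhds hδ] with s hs
    refine csSup_le' ?_
    rintro _ ⟨τ, x, -, hx, rfl⟩
    exact H x (hx.trans hs.le) τ

end IsAttractiveSemiflow

/-! ### Uniform asymptotic stability and coercive functionals -/

theorem IsFlow.isAttractiveSemiflow (hΦ : IsFlow f Φ) (hr : 0 < r) (hp : 1 < p)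
    (hf : RhsLipschitzOnBounded f) (hf0 : f 0 = 0)
    (hfc : ForwardCompleteOn f (sobolevSet n r p)) (h : UniformlyAttractive Φ) :
    IsAttractiveSemiflow (fun x : Sobolev n r p => sobolevNorm p x.1)
      (fun x y => sobolevNorm p (x.1 - y.1)) ⟨0, zero_mem_sobolevSet hr hp⟩ Φ where
  zero_apply := hΦ.zero_apply
  add_apply := hΦ.add_apply hr hf
  apply_zero := hΦ.apply_zero hr hp hf hf0
  norm_zero := sobolevNorm_zero hr hp
  dist_zero x := by simp
  dist_comm x y := sobolevNorm_sub_comm hr hp x.2 y.2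
  norm_le_add x y := sobolevNorm_le_add_sub hr hp x.2 y.2
  lipschitz := hΦ.exists_lipschitz hr hp hf hfc
  attractive := h

theorem IsFlow.ugas_of_gas (hΦ : IsFlow f Φ) (hr : 0 < r) (hp : 1 < p)
    (hf : RhsLipschitzOnBounded f) (hf0 : f 0 = 0)
    (hfc : ForwardCompleteOn f (sobolevSet n r p)) (h : GAS p f) : UGAS p f := by
  obtain ⟨σ, hσ, hle⟩ := (hΦ.isAttractiveSemiflow hr hp hf hf0 hfc
    (hΦ.uniformlyAttractive_of_gas hr hp hf hf0 hfc h)).exists_classKL (fun ε hε => by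
      obtain ⟨δ, hδ, H⟩ := h.1 ε hε
      refine ⟨δ, hδ, fun x hx t => ?_⟩
      obtain ⟨φ, hφ, hφε⟩ := H x hx
      rw [← hΦ.trajectory_eq hr hf hφ]
      exact hφε t)
  exact ⟨σ, hσ, fun x₀ => ⟨_, hΦ x₀, hle x₀⟩⟩

theorem IsFlow.uniformlyAttractive_of_ugas (hΦ : IsFlow f Φ) (hr : 0 < r)
    (hf : RhsLipschitzOnBounded f) (h : UGAS p f) : UniformlyAttractive Φ := by
  obtain ⟨σ, hσ, H⟩ := h
  intro R ε hε
  obtain ⟨T, hT⟩ := eventually_atTop.1 ((hσ.tendsto_zero R).eventually_lt_const hε)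
  refine ⟨T, fun t ht x hx => ?_⟩
  obtain ⟨φ, hφ, hφσ⟩ := H x
  rw [← hΦ.trajectory_eq hr hf hφ]
  exact (hφσ t).trans (((hσ.classK t).strictMono.monotone hx).trans (hT t ht).le)

/-- The quotient is dominated by that of `e^{-t} v`, whose derivative at zero is `-v`. -/
theorem limsup_le_of_mul_expNN_le {u : ℝ≥0 → ℝ≥0} {v : ℝ≥0} (h : ∀ t, u t * expNN t ≤ v) :
    limsup (fun t : ℝ≥0 => (((t : ℝ)⁻¹ * ((u t : ℝ) - v) : ℝ) : EReal)) (𝓝[>] 0) ≤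
      ((-(v : ℝ) : ℝ) : EReal) := by
  have hd : HasDerivAt (fun t : ℝ => Real.exp (-t)) (-1) 0 := by
    simpa using (hasDerivAt_neg (0 : ℝ)).exp
  have hc : Tendsto (fun t : ℝ≥0 => (t : ℝ)) (𝓝[>] 0) (𝓝[≠] 0) := by
    refine tendsto_nhdsWithin_iff.2 ⟨?_, ?_⟩
    · exact (NNReal.continuous_coe.tendsto 0).mono_left nhdsWithin_le_nhds
    · filter_upwards [self_mem_nhdsWithin] with t ht
      simpa using (mem_Ioi.1 ht).ne'
  have hlim := ((hd.tendsto_slope_zero.comp hc).mul_const (v : ℝ))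
  have hlim' := (continuous_coe_real_ereal.tendsto _).comp hlim
  rw [neg_one_mul] at hlim'
  rw [← hlim'.limsup_eq]
  refine limsup_le_limsup ?_
  filter_upwards [self_mem_nhdsWithin] with t ht
  have ht0 : (0 : ℝ) < t := by exact_mod_cast ht
  simp only [Function.comp_apply, EReal.coe_le_coe_iff, zero_add, neg_zero, Real.exp_zero,
    smul_eq_mul]
  rw [mul_assoc]
  refine mul_le_mul_of_nonneg_left ?_ (by positivity)
  have h1 : (u t : ℝ) * Real.exp t ≤ v := by rw [← coe_expNN]; exact_mod_cast h t
  have h2 : (u t : ℝ) ≤ Real.exp (-t) * v := by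
    rw [Real.exp_neg, ← div_eq_inv_mul, le_div_iff₀ (Real.exp_pos _)]
    exact h1
  linarith

theorem IsFlow.hasCoerciveFunctional_of_ugas (hΦ : IsFlow f Φ) (hr : 0 < r) (hp : 1 < p)
    (hf : RhsLipschitzOnBounded f) (hf0 : f 0 = 0)
    (hfc : ForwardCompleteOn f (sobolevSet n r p)) (h : UGAS p f) : HasCoerciveFunctional p f := by
  have hS := hΦ.isAttractiveSemiflow hr hp hf hf0 hfc (hΦ.uniformlyAttractive_of_ugas hr hf h)
  obtain ⟨V, a, L, ha, hL, hV0, hVL, haV, hdec⟩ := hS.exists_lyapunov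
  obtain ⟨ρ, hρ, hLρ⟩ := exists_classKInf_mul_le hL
  refine ⟨V, a, ρ, ⟨L, hL, fun R x y hx hy => ?_⟩, ha, hρ, fun x => ⟨haV x, ?_, _, hΦ x, ?_⟩⟩
  · have h1 := hVL R x y hx hy
    have h2 := hVL R y x hy hx
    rw [sobolevNorm_sub_comm hr hp y.2 x.2] at h2
    rw [← NNReal.coe_le_coe] at h1 h2
    push_cast at h1 h2
    rw [abs_sub_le_iff]
    constructor <;> linarith
  · have h1 := hVL (sobolevNorm p x.1) x ⟨0, zero_mem_sobolevSet hr hp⟩ le_rfl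
      (by simp [sobolevNorm_zero hr hp])
    rw [hV0, zero_add, sub_zero] at h1
    exact h1.trans (hLρ _)
  · exact limsup_le_of_mul_expNN_le fun t => hdec t x

theorem norm_evalZero_le (hr : 0 < r) (x : History n r) : ‖evalZero hr x‖₊ ≤ sobolevNorm p x :=
  (x.norm_coe_le_norm _ : ‖evalZero hr x‖₊ ≤ ‖x‖₊).trans (nnnorm_le_sobolevNorm x)

theorem hasPointwiseFunctional_of_hasCoerciveFunctional (hr : 0 < r)
    (h : HasCoerciveFunctional p f) : HasPointwiseFunctional hr p f := by
  obtain ⟨V, a₁, a₂, hV, ha₁, ha₂, H⟩ := h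
  have hle : ∀ x : Sobolev n r p, a₁ ‖evalZero hr x.1‖₊ ≤ V x := fun x =>
    (ha₁.strictMono.monotone (norm_evalZero_le hr x.1)).trans (H x).1
  refine ⟨V, fun v => a₁ ‖v‖₊, a₁, a₂, hV, ha₁.continuous.comp continuous_nnnorm, fun v => ?_,
    ha₁, ha₂, fun x => ⟨hle x, (H x).2.1, ?_⟩⟩
  · rw [← ha₁.map_zero, ha₁.strictMono.injective.eq_iff, nnnorm_eq_zero]
  · obtain ⟨φ, hφ, hlim⟩ := (H x).2.2
    refine ⟨φ, hφ, hlim.trans ?_⟩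
    rw [EReal.coe_le_coe_iff, neg_le_neg_iff]
    exact_mod_cast hle x

/-! ### Functionals with pointwise dissipation -/

section Pointwise

variable {V : Sobolev n r p → ℝ≥0}

/-- Dini derivatives control growth only for continuous functions. As `V` is Lipschitz merely in the
Sobolev norm, continuity of the segments in that norm is required. -/
theorem IsFlow.continuousOn_functional (hΦ : IsFlow f Φ) (hr : 0 < r) (hp : 1 < p)
    (hf : RhsLipschitzOnBounded f) (hV : FunctionalLipschitzOnBounded V) (x₀ : Sobolev n r p) :
    ContinuousOn (fun t : ℝ => (V (Φ t.toNNReal x₀) : ℝ)) (Ici 0) := by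
  obtain ⟨L, -, hL⟩ := hV
  obtain ⟨x, hx, hxΦ⟩ := hΦ x₀
  intro t ht
  have hN := hx.tendsto_sobolevNorm_sub hr hp hf x₀.2 ht
  rw [ContinuousWithinAt, tendsto_iff_dist_tendsto_zero]
  have hN' := (NNReal.tendsto_coe.2 hN).const_mul
    (L (sobolevNorm p (Φ t.toNNReal x₀).1 + 1) : ℝ)
  rw [NNReal.coe_zero, mul_zero] at hN'
  refine tendsto_of_tendsto_of_tendsto_of_le_of_le' tendsto_const_nhds hN'
    (.of_forall fun _ => dist_nonneg) ?_
  filter_upwards [self_mem_nhdsWithin, hN.eventually_lt_const one_pos] with s hs hs1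
  have hst : sobolevNorm p ((Φ s.toNNReal x₀).1 - (Φ t.toNNReal x₀).1) =
      sobolevNorm p (histSegment r x s - histSegment r x t) := by
    rw [hxΦ, hxΦ, Real.coe_toNNReal _ hs, Real.coe_toNNReal _ ht]
  rw [Real.dist_eq, ← hst]
  refine hL _ _ _ ?_ le_self_add
  refine (sobolevNorm_le_add_sub hr hp (Φ s.toNNReal x₀).2 (Φ t.toNNReal x₀).2).trans ?_
  rw [hst]
  gcongr

/-- The semigroup law moves the Dini estimate from time zero to any time `s`. -/
theorem IsFlow.eventually_slope_lt (hΦ : IsFlow f Φ) (hr : 0 < r) (hf : RhsLipschitzOnBounded f)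
    {x₀ : Sobolev n r p} {s b c : ℝ} (hs : 0 ≤ s) (hD : DiniAlongLE f V (Φ s.toNNReal x₀) b)
    (hbc : b < c) :
    ∀ᶠ z in 𝓝[>] s, slope (fun t : ℝ => (V (Φ t.toNNReal x₀) : ℝ)) s z < c := by
  obtain ⟨φ, hφ, hlim⟩ := hD
  have hev := eventually_lt_of_limsup_lt (hlim.trans_lt (EReal.coe_lt_coe_iff.2 hbc))
  have hc : Tendsto (fun z : ℝ => (z - s).toNNReal) (𝓝[>] s) (𝓝[>] 0) := by
    refine tendsto_nhdsWithin_iff.2 ⟨?_, ?_⟩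
    · have : Continuous fun z : ℝ => (z - s).toNNReal := by fun_prop
      simpa using (this.tendsto s).mono_left nhdsWithin_le_nhds
    · filter_upwards [self_mem_nhdsWithin] with z hz
      simpa using hz
  filter_upwards [hc.eventually hev, self_mem_nhdsWithin] with z hz hzs
  have hzs' : 0 ≤ z - s := sub_nonneg.2 (le_of_lt hzs)
  rw [EReal.coe_lt_coe_iff, hΦ.trajectory_eq hr hf hφ, ← hΦ.add_apply hr hf,
    ← Real.toNNReal_add hzs' hs, sub_add_cancel, Real.coe_toNNReal _ hzs'] at hz
  rwa [slope_def_field, div_eq_inv_mul]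

theorem IsFlow.functional_le_sub (hΦ : IsFlow f Φ) (hr : 0 < r) (hp : 1 < p)
    (hf : RhsLipschitzOnBounded f) (hV : FunctionalLipschitzOnBounded V) {Q : Vec n → ℝ≥0}
    (hD : ∀ x : Sobolev n r p, DiniAlongLE f V x (-(Q (evalZero hr x.1) : ℝ)))
    {x₀ : Sobolev n r p} (hx : IsSolution f x₀ x) {a b q : ℝ} (ha : 0 ≤ a) (hab : a ≤ b)
    (hq : ∀ u ∈ Ico a b, q ≤ Q (x u)) :
    (V (Φ b.toNNReal x₀) : ℝ) ≤ V (Φ a.toNNReal x₀) - q * (b - a) := by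
  refine image_le_of_liminf_slope_right_le_deriv_boundary
    (f := fun t : ℝ => (V (Φ t.toNNReal x₀) : ℝ))
    (B := fun t => (V (Φ a.toNNReal x₀) : ℝ) - q * (t - a)) (B' := fun _ => -q)
    ((hΦ.continuousOn_functional hr hp hf hV x₀).mono fun t ht => ha.trans ht.1) (by simp)
    (by fun_prop) (fun t _ => ?_) (fun t ht c hc => ?_) ⟨hab, le_rfl⟩
  · have := ((((hasDerivAt_id t).sub_const a).const_mul q).const_sub
      (V (Φ a.toNNReal x₀) : ℝ)).hasDerivWithinAt (s := Ici t)
    simpa using this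
  · have ht0 : 0 ≤ t := ha.trans ht.1
    refine (hΦ.eventually_slope_lt hr hf ht0 (hD _) (lt_of_le_of_lt ?_ hc)).frequently
    have heval : evalZero hr (Φ t.toNNReal x₀).1 = x t := by
      rw [hΦ.apply_eq hr hf hx, evalZero, histSegment_apply, Real.coe_toNNReal _ ht0]
      simp
    rw [heval]
    exact neg_le_neg (hq t ht)

theorem exists_pos_le_one_mul_le {K ε : ℝ} (hK : 0 ≤ K) (hε : 0 < ε) :
    ∃ η : ℝ, 0 < η ∧ η ≤ 1 ∧ K * η ≤ ε := by
  refine ⟨min 1 (ε / (K + 1)), lt_min one_pos (by positivity), min_le_left _ _, ?_⟩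
  calc K * min 1 (ε / (K + 1)) ≤ K * (ε / (K + 1)) := by gcongr; exact min_le_right _ _
    _ ≤ (K + 1) * (ε / (K + 1)) := by gcongr; linarith
    _ = ε := mul_div_cancel₀ _ (by positivity)

theorem norm_apply_le_of_histSegment (hf0 : f 0 = 0) {L M : ℝ} (hM0 : 0 ≤ M) (hL0 : 0 ≤ L)
    (hL : ∀ x y : History n r, ‖x‖ ≤ M → ‖y‖ ≤ M → ‖f x - f y‖ ≤ L * ‖x - y‖) {z : History n r}
    {η : ℝ} (hη : η ≤ M) (hz : ‖z‖ ≤ η) : ‖f z‖ ≤ L * η := by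
  have := hL z 0 (hz.trans hη) (by simpa using hM0)
  rw [hf0, sub_zero, sub_zero] at this
  exact this.trans (by gcongr)

/-- A bounded solution along which a functional decreases by the integral of a positive definite
function of `x t` tends to zero. -/
theorem eventually_norm_lt_of_decrease {v : ℝ → ℝ} {Q : Vec n → ℝ≥0} (hQ : Continuous Q)
    (hQ0 : ∀ v, Q v = 0 ↔ v = 0) (hv0 : ∀ t, 0 ≤ v t)
    (hdec : ∀ a b q : ℝ, 0 ≤ a → a ≤ b → (∀ u ∈ Ico a b, q ≤ Q (x u)) → v b ≤ v a - q * (b - a))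
    {M B : ℝ} (hB : 0 ≤ B) (hM : ∀ t, 0 ≤ t → ‖x t‖ ≤ M)
    (hlip : ∀ s t, 0 ≤ s → s ≤ t → ‖x t - x s‖ ≤ B * (t - s)) {ε : ℝ} (hε : 0 < ε) :
    ∀ᶠ t in atTop, ‖x t‖ < ε := by
  have hK : IsCompact {w : Vec n | ε / 2 ≤ ‖w‖ ∧ ‖w‖ ≤ M} := by
    refine (isCompact_closedBall (0 : Vec n) M).of_isClosed_subset
      ((isClosed_le continuous_const continuous_norm).inter
        (isClosed_le continuous_norm continuous_const)) fun w hw => ?_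
    simpa using hw.2
  obtain ⟨q, hq, hqQ⟩ := hK.exists_forall_le' (f := fun w => (Q w : ℝ)) (a := 0) (by fun_prop)
    fun w hw => by
      have : w ≠ 0 := fun h => by
        have := hw.1
        rw [h, norm_zero] at this
        linarith
      exact NNReal.coe_pos.2 (pos_iff_ne_zero.2 fun h => this ((hQ0 w).1 h))
  set τ := ε / (2 * (B + 1)) with hτ
  have hτ0 : 0 < τ := by positivity
  have hBτ : B * τ ≤ ε / 2 := by
    rw [hτ, mul_div_assoc', div_le_div_iff₀ (by positivity) (by positivity)]
    nlinarith
  have hbdd : BddBelow (v '' Ici 0) := ⟨0, by rintro _ ⟨t, -, rfl⟩; exact hv0 t⟩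
  -- From `T` on, `v` is within `q τ` of its infimum. If `‖x t‖ ≥ ε`, then `‖x‖ ≥ ε / 2` on `[t, t +
  -- τ)` by the choice of `τ`, and `v` would fall by `q τ`, below its infimum.
  obtain ⟨_, ⟨T, hT, rfl⟩, hTlt⟩ := exists_lt_of_csInf_lt (nonempty_Ici.image v)
    (lt_add_of_pos_right (sInf (v '' Ici 0)) (mul_pos hq hτ0))
  filter_upwards [eventually_ge_atTop T] with t ht
  have ht0 : 0 ≤ t := le_trans hT ht
  by_contra! hcon
  have h1 := hdec T t 0 hT ht fun u _ => NNReal.coe_nonneg _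
  have h2 := hdec t (t + τ) q ht0 (by linarith) fun u hu => hqQ _ ⟨?_, hM u (ht0.trans hu.1)⟩
  · have h3 := csInf_le hbdd (mem_image_of_mem v (show t + τ ∈ Ici 0 by
      simp only [mem_Ici]; linarith))
    have : q * (t + τ - t) = q * τ := by ring
    linarith
  · have h3 := hlip t u ht0 hu.1
    have h4 : B * (u - t) ≤ B * τ := by gcongr; linarith [hu.2]
    have h5 := norm_le_norm_add_norm_sub (x u) (x t)
    linarith

theorem IsSolution.norm_sub_le (hx : IsSolution f x₀ x) {B : ℝ}
    (hB : ∀ t, 0 ≤ t → ‖f (histSegment r x t)‖ ≤ B) {s t : ℝ} (hs : 0 ≤ s) (hst : s ≤ t) :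
    ‖x t - x s‖ ≤ B * (t - s) :=
  norm_image_sub_le_of_norm_deriv_right_le_segment x.continuous.continuousOn
    (fun _ hu => hx.hasDerivWithinAt_Ici (hs.trans hu.1)) (fun _ hu => hB _ (hs.trans hu.1)) t
    ⟨hst, le_rfl⟩

theorem IsFlow.gas_of_hasPointwiseFunctional (hΦ : IsFlow f Φ) (hr : 0 < r) (hp : 1 < p)
    (hf : RhsLipschitzOnBounded f) (hf0 : f 0 = 0) (h : HasPointwiseFunctional hr p f) :
    GAS p f := by
  obtain ⟨V, Q, a₁, a₂, hV, hQ, hQ0, ha₁, ha₂, H⟩ := h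
  have hdec := fun {x₀ : Sobolev n r p} {x : C(ℝ, Vec n)} (hx : IsSolution f x₀ x) {a b q : ℝ} =>
    hΦ.functional_le_sub hr hp hf hV (fun x => (H x).2.2) hx (a := a) (b := b) (q := q)
  -- For `u ≥ 0`, `a₁ |x(u)| ≤ V(x_u) ≤ V(x₀) ≤ a₂ ‖x₀‖ ≤ a₁ M`. Bounding `x` at single times is
  -- enough, since a segment consists of such values and of initial ones.
  have hbound : ∀ (x₀ : Sobolev n r p) (x : C(ℝ, Vec n)), IsSolution f x₀ x → ∀ M : ℝ≥0,
      sobolevNorm p x₀.1 ≤ M → a₂ (sobolevNorm p x₀.1) ≤ a₁ M →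
      ∀ t, 0 ≤ t → ‖histSegment r x t‖ ≤ M := by
    intro x₀ x hx M hM hle t ht
    rw [norm_histSegment_le_iff M.coe_nonneg]
    intro u hu
    rcases le_total u 0 with hu0 | hu0
    · have hmem : u ∈ Icc (-r) (0 : ℝ) := ⟨by linarith [hu.1], hu0⟩
      rw [hx.apply_of_mem hmem, extendZero_apply _ hmem]
      exact (x₀.1.norm_coe_le_norm _).trans ((norm_le_sobolevNorm _).trans (by exact_mod_cast hM))
    · have h1 := hdec hx (a := 0) (b := u) (q := 0) le_rfl hu0 fun _ _ => NNReal.coe_nonneg _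
      rw [zero_mul, sub_zero, NNReal.coe_le_coe, Real.toNNReal_zero, hΦ.zero_apply] at h1
      have h2 := (H (Φ u.toNNReal x₀)).1
      have heval : evalZero hr (Φ u.toNNReal x₀).1 = x u := by
        rw [hΦ.apply_eq hr hf hx, evalZero, histSegment_apply, Real.coe_toNNReal _ hu0]
        simp
      rw [heval] at h2
      exact ha₁.strictMono.le_iff_le.1 (h2.trans (h1.trans ((H x₀).2.1.trans hle)))
  obtain ⟨L, hL0, hL⟩ := hf.exists_const 1
  refine ⟨fun ε hε => ?_, fun x₀ => ?_⟩
  -- The factor collects the sup norm, the initial derivative and the part of the derivative given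
  -- by `f`, each controlled by `η`. For attractivity below, the middle term is absent.
  · obtain ⟨η, hη, hη1, hηε⟩ := exists_pos_le_one_mul_le
      (K := 1 + 1 + r ^ (1 / (p : ℝ)) * L) (by positivity) (NNReal.coe_pos.2 hε)
    lift η to ℝ≥0 using hη.le
    have hη' : 0 < η := by exact_mod_cast hη
    have hev : ∀ᶠ s in 𝓝[>] (0 : ℝ≥0), a₂ s < a₁ η := by
      have h1 := ha₂.continuous.tendsto 0
      have h2 := ha₁.strictMono hη'
      rw [ha₂.map_zero] at h1
      rw [ha₁.map_zero] at h2
      exact (h1.eventually_lt_const h2).filter_mono nhdsWithin_le_nhds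
    obtain ⟨δ, hδ⟩ := (hev.and (Ioo_mem_nhdsGT hη')).exists
    refine ⟨δ, hδ.2.1, fun x₀ hx₀ => ⟨_, hΦ x₀, fun t => ?_⟩⟩
    obtain ⟨x, hx, hxΦ⟩ := hΦ x₀
    have hb := hbound x₀ x hx η (hx₀.trans hδ.2.2.le)
      ((ha₂.strictMono.monotone hx₀).trans hδ.1.le)
    rw [hxΦ, ← NNReal.coe_le_coe]
    refine (hx.sobolevNorm_histSegment_le hr hp hf hf0 x₀.2 t.coe_nonneg (A := η) (B := L * η)
      hη.le (by positivity) (fun _ => ?_) fun u _ hu0 => ?_).trans ?_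
    · exact_mod_cast hx₀.trans hδ.2.2.le
    · exact norm_apply_le_of_histSegment hf0 zero_le_one hL0 hL hη1 (hb u hu0)
    · have := hb t t.coe_nonneg
      linarith
  · refine ⟨_, hΦ x₀, ?_⟩
    obtain ⟨x, hx, hxΦ⟩ := hΦ x₀
    obtain ⟨M, hM, hMa⟩ := ((eventually_ge_atTop (sobolevNorm p x₀.1)).and
      (ha₁.tendsto_atTop.eventually_ge_atTop (a₂ (sobolevNorm p x₀.1)))).exists
    have hb := hbound x₀ x hx M hM hMa
    obtain ⟨K, hK0, hK⟩ := hf.exists_const M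
    have hfb : ∀ t, 0 ≤ t → ‖f (histSegment r x t)‖ ≤ K * M := fun t ht =>
      norm_apply_le_of_histSegment hf0 M.coe_nonneg hK0 hK le_rfl (hb t ht)
    have hconv : ∀ η : ℝ, 0 < η → ∀ᶠ t in atTop, ‖x t‖ < η := fun η hη =>
      eventually_norm_lt_of_decrease (v := fun t => V (Φ t.toNNReal x₀)) hQ hQ0
        (fun t => NNReal.coe_nonneg _) (fun a b q ha hab hq => hdec hx ha hab hq)
        (by positivity)
        (fun t ht => (norm_apply_le_histSegment ⟨by linarith, le_rfl⟩).trans (hb t ht))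
        (fun s t hs hst => hx.norm_sub_le hfb hs hst) hη
    refine tendsto_order.2 ⟨fun a ha => absurd ha not_lt_zero, fun ε hε => ?_⟩
    obtain ⟨ε', hε', hlt⟩ := exists_between hε
    obtain ⟨η, hη, hη1, hηε⟩ := exists_pos_le_one_mul_le
      (K := 1 + r ^ (1 / (p : ℝ)) * L) (by positivity) (NNReal.coe_pos.2 hε')
    obtain ⟨T, hT⟩ := eventually_atTop.1 (hconv η hη)
    have hseg : ∀ u, T + r ≤ u → ‖histSegment r x u‖ ≤ η := by
      intro u hu
      rw [norm_histSegment_le_iff hη.le]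
      exact fun s hs => (hT s (by linarith [hs.1])).le
    -- Two delays are needed: the derivative on `[t - r, t]` depends on segments reaching back to `t
    -- - 2 r`. The maximum with `0` ensures `t ≥ r`, so the initial derivative has left the window.
    filter_upwards [(NNReal.tendsto_coe_atTop.2 tendsto_id).eventually_ge_atTop
      (max T 0 + 2 * r)] with t ht
    have ht1 : T + 2 * r ≤ t := le_trans (by gcongr; exact le_max_left _ _) ht
    have ht2 : 0 + 2 * r ≤ t := le_trans (by gcongr; exact le_max_right _ _) ht
    refine lt_of_le_of_lt ?_ hlt
    rw [hxΦ, ← NNReal.coe_le_coe]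
    refine (hx.sobolevNorm_histSegment_le hr hp hf hf0 x₀.2 t.coe_nonneg (A := 0) (B := L * η)
      le_rfl (by positivity) (fun h => by linarith) fun u hu hu0 => ?_).trans ?_
    · exact norm_apply_le_of_histSegment hf0 zero_le_one hL0 hL hη1
        (hseg u (by linarith [hu.1]))
    · have := hseg t (by linarith)
      linarith

end Pointwise

end DelaySystem

theorem theorem6 (n : ℕ) (r : ℝ) (hr : 0 < r) (p : ℝ≥0) (hp : 1 < p)
    (f : DelaySystem.History n r → DelaySystem.Vec n) (hf0 : f 0 = 0)
    (hf : DelaySystem.RhsLipschitzOnBounded f)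
    (hfc : DelaySystem.ForwardCompleteOn f (DelaySystem.holderSet n r (1 - 1 / p))) :
    List.TFAE [DelaySystem.GAS p f,
      DelaySystem.UGAS p f,
      DelaySystem.HasCoerciveFunctional p f,
      DelaySystem.HasPointwiseFunctional hr p f] := by
  have hfc' : DelaySystem.ForwardCompleteOn f (DelaySystem.sobolevSet n r p) := fun x₀ hx₀ =>
    hfc x₀ (DelaySystem.sobolevSet_subset_holderSet hr hp hx₀)
  obtain ⟨Φ, hΦ⟩ := DelaySystem.exists_isFlow hr hp hf hfc'
  tfae_have 1 → 2 := hΦ.ugas_of_gas hr hp hf hf0 hfc'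
  tfae_have 2 → 3 := hΦ.hasCoerciveFunctional_of_ugas hr hp hf hf0 hfc'
  tfae_have 3 → 4 := DelaySystem.hasPointwiseFunctional_of_hasCoerciveFunctional hr
  tfae_have 4 → 1 := hΦ.gas_of_hasPointwiseFunctional hr hp hf hf0
  tfae_finish
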